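/- **Setting.** A space of homogeneous type $(S,d,\mu)$ with constants $c_d,c_\mu\ge 1$ is a set $S$ with a quasi-metric $d$ (symmetric, $d(s,t)=0$ iff $s=t$, and $d(s,t)\le c_d(d(s,u)+d(u,t))$) and a measure $\mu$ on the Borel $\sigma$-algebra of $(S,d)$ such that all balls $B(s,\rho)=\{t: d(s,t)<\rho\}$, $\rho>0$, are Borel sets with $0<\mu(B(s,\rho))<\infty$ and $\mu(B(s,2\rho))\le c_\mu\,\mu(B(s,\rho))$. For $0<c_0\le C_0$ and $0<\delta<1$, a *dyadic system* with parameters $c_0,C_0,\delta$ is a family $(\mathscr D_k)_{k\in\mathbb Z}$ of collections of measurable sets (*cubes*) such that each $\mathscr D_k$ is pairwise disjoint with union $S$; for $k\ge l$, $Q\in\mathscr D_k$, $Q'\in\mathscr D_l$ either $Q\cap Q'=\emptyset$ or $Q\subseteq Q'$; and every $Q\in\mathscr D_k$ satisfies $B(z,c_0\delta^k)\subseteq Q\subseteq B(z,C_0\delta^k)$ for some $z\in S$. Dyadic systems $\mathscr D^1,\dots,\mathscr D^m$ with the same parameters $c_0,C_0,\delta$ are called *adjacent* with constant $\gamma\ge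 1$ if for all $s\in S$, $\rho>0$ there are $j$ and a cube $Q$ of $\mathscr D^j$ with $B(s,\rho)\subseteq Q$ and $\operatorname{diam}(Q)\le\gamma\rho$. A collection $\mathcal S$ of cubes is *$\eta$-sparse* if there are pairwise disjoint measurable $E_Q\subseteq Q$, $Q\in\mathcal S$, with $\mu(E_Q)\ge\eta\,\mu(Q)$. Write $\langle\|f\|_X\rangle_{p,Q}=\big(\frac1{\mu(Q)}\int_Q\|f\|_X^p\,d\mu\big)^{1/p}$ and $\|g\|_{L^{p,\infty}}=\sup_{t>0}t\,\mu(\|g\|>t)^{1/p}$. For a linear operator $T$ from $L^{p_1}(S;X)$ to the ($\mu$-a.e. classes of) strongly measurable functions $S\to Y$, and $\alpha\ge1$, put $$\mathcal M^{\#}_{T,\alpha}f(s)=\sup_{B\ni s}\ \operatorname*{ess\,sup}_{s',s''\in B}\ \big\|T(f\mathbf 1_{S\setminus\alpha B})(s')-T(f\mathbf 1_{S\setminus\alpha B})(s'')\big\|_Y,\qquad s\in S,$$ the supremum being over all balls $B=B(z,\rho)$ containing $s$, with $\alpha B=B(z,\alpha\rho)$; here $f\in L^{p_1}(S;X)$.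 The norm $\|T\|_{L^{p_1}\to L^{p_1,\infty}}$ is the least $A\in[0,\infty]$ with $\|Tf\|_{L^{p_1,\infty}}\le A\|f\|_{L^{p_1}}$ for all $f\in L^{p_1}(S;X)$, and $\|\mathcal M^{\#}_{T,\alpha}\|_{L^{p_2}\to L^{p_2,\infty}}$ is the least $A\in[0,\infty]$ with $\|\mathcal M^{\#}_{T,\alpha}f\|_{L^{p_2,\infty}}\le A\|f\|_{L^{p_2}}$ for all $f\in L^{p_1}(S;X)\cap L^{p_2}(S;X)$. **Theorem.** Let $c_d,c_\mu\ge1$. (a) There are $0<c_0\le C_0<\infty$, $0<\delta<1$, $\gamma\ge1$ and $m\in\mathbb N$, depending only on $c_d$ and $c_\mu$, such that every space of homogeneous type with constants $c_d,c_\mu$ has adjacent dyadic systems $\mathscr D^1,\dots,\mathscr D^m$ with parameters $c_0,C_0,\delta$ and constant $\gamma$. (b) Let $0<c_0\le C_0<\infty$, $0<\delta<1$, $\gamma\ge1$, $m\in\mathbb N$ and $\alpha\ge 3c_d^2/\delta$. There are $\eta\in(0,1)$ and $C<\infty$, depending only on $c_d,c_\mu,\alpha,c_0,C_0,\delta,\gamma,m$,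 such that the following holds. Let $(S,d,\mu)$ be a space of homogeneous type with constants $c_d,c_\mu$, let $\mathscr D^1,\dots,\mathscr D^m$ be adjacent dyadic systems on it with parameters $c_0,C_0,\delta$ and constant $\gamma$, let $X$ and $Y$ be (real or complex) Banach spaces, let $p_1,p_2,r\in[1,\infty)$, and set $p_0=\max\{p_1,p_2\}$. Assume: - $T$ is a bounded linear operator from $L^{p_1}(S;X)$ to $L^{p_1,\infty}(S;Y)$, i.e. $\|T\|_{L^{p_1}\to L^{p_1,\infty}}<\infty$; - $\|\mathcal M^{\#}_{T,\alpha}\|_{L^{p_2}\to L^{p_2,\infty}}<\infty$; - there is $C_r>0$ such that for all $n$ and all disjointly and boundedly supported $f_1,\dots,f_n\in L^{p_0}(S;X)$, $$\Big\|T\Big(\sum_{k=1}^nf_k\Big)(s)\Big\|_Y\le C_r\Big(\sum_{k=1}^n\|Tf_k(s)\|_Y^r\Big)^{1/r}\qquad\text{for a.e. }s\in S.$$ Then for every boundedly supported $f\in L^{p_0}(S;X)$ there is an $\eta$-sparse collection $\mathcal S$ of cubes of $\mathscr D^1,\dots,\mathscr D^m$ such that $$\|Tf(s)\|_Y\le C\,C_T\,C_r\Big(\sum_{Q\in\mathcal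 S}\langle\|f\|_X\rangle_{p_0,Q}^r\,\mathbf 1_Q(s)\Big)^{1/r}\qquad\text{for a.e. }s\in S,$$ where $C_T=\|T\|_{L^{p_1}\to L^{p_1,\infty}}+\|\mathcal M^{\#}_{T,\alpha}\|_{L^{p_2}\to L^{p_2,\infty}}$. -/

import Mathlib

open MeasureTheory Set
open scoped ENNReal NNReal

universe u v w x

noncomputable section

namespace SparseDom

/-- `B(s, ρ) = {t : d(s, t) < ρ}`. -/
def qball {S : Type*} (d : S → S → ℝ) (s : S) (ρ : ℝ) : Set S := {t | d s t < ρ}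

/-- The topology of a quasi-metric `d`: a set is open when it contains, with each of its points,
a ball around that point. -/
abbrev qtopology {S : Type*} (d : S → S → ℝ) : TopologicalSpace S where
  IsOpen U := ∀ s ∈ U, ∃ ε : ℝ, 0 < ε ∧ qball d s ε ⊆ U
  isOpen_univ := fun _ _ => ⟨1, one_pos, subset_univ _⟩
  isOpen_inter := by
    intro U V hU hV s hs
    obtain ⟨ε, hε, h⟩ := hU s hs.1
    obtain ⟨ε', hε', h'⟩ := hV s hs.2
    refine ⟨min ε ε', lt_min hε hε', fun t ht => ⟨h ?_, h' ?_⟩⟩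
    · exact lt_of_lt_of_le (show d s t < min ε ε' from ht) (min_le_left _ _)
    · exact lt_of_lt_of_le (show d s t < min ε ε' from ht) (min_le_right _ _)
  isOpen_sUnion := by
    intro F hF s hs
    obtain ⟨U, hU, hsU⟩ := hs
    obtain ⟨ε, hε, h⟩ := hF U hU s hsU
    exact ⟨ε, hε, h.trans (subset_sUnion_of_mem hU)⟩

/-- `d` is a quasi-metric with quasi-metric constant `c_d`. -/
structure IsQuasiMetric {S : Type*} (d : S → S → ℝ) (c_d : ℝ) : Prop where
  one_le : 1 ≤ c_d
  nonneg : ∀ s t, 0 ≤ d s t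
  eq_zero_iff : ∀ s t, d s t = 0 ↔ s = t
  symm : ∀ s t, d s t = d t s
  quasi_triangle : ∀ s t u, d s t ≤ c_d * (d s u + d u t)

/-- `(S, d, μ)` is a space of homogeneous type with quasi-metric constant `c_d` and doubling
constant `c_μ`: `μ` is a Borel measure, all balls are Borel sets of positive finite measure,
and `μ` is doubling. -/
structure IsHomogeneousType {S : Type*} [mS : MeasurableSpace S] (d : S → S → ℝ) (μ : Measure S)
    (c_d c_μ : ℝ) : Prop where
  isQuasiMetric : IsQuasiMetric d c_d
  borel_eq : mS = @borel S (qtopology d)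
  measurableSet_ball : ∀ s ρ, 0 < ρ → MeasurableSet (qball d s ρ)
  ball_pos : ∀ s ρ, 0 < ρ → 0 < μ (qball d s ρ)
  ball_lt_top : ∀ s ρ, 0 < ρ → μ (qball d s ρ) < ∞
  one_le : 1 ≤ c_μ
  doubling : ∀ s ρ, 0 < ρ → μ (qball d s (2 * ρ)) ≤ ENNReal.ofReal c_μ * μ (qball d s ρ)

/-- `𝒟` is a dyadic system with parameters `c₀`, `C₀`, `δ`; here `𝒟 k` is the collection of
cubes of generation `k`. -/
structure IsDyadicSystem {S : Type*} [MeasurableSpace S] (d : S → S → ℝ) (c₀ C₀ δ : ℝ)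
    (𝒟 : ℤ → Set (Set S)) : Prop where
  measurableSet : ∀ k, ∀ Q ∈ 𝒟 k, MeasurableSet Q
  disjoint : ∀ k, (𝒟 k).PairwiseDisjoint id
  cover : ∀ k, ⋃₀ (𝒟 k) = univ
  nested : ∀ k l, l ≤ k → ∀ Q ∈ 𝒟 k, ∀ Q' ∈ 𝒟 l, Q ∩ Q' = ∅ ∨ Q ⊆ Q'
  center : ∀ k, ∀ Q ∈ 𝒟 k, ∃ z, qball d z (c₀ * δ ^ k) ⊆ Q ∧ Q ⊆ qball d z (C₀ * δ ^ k)

/-- `𝒟 0, …, 𝒟 (m - 1)` are dyadic systems with parameters `c₀`, `C₀`, `δ` such that every ball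
`B(s, ρ)` lies in a cube of one of them of diameter at most `γ ρ`. -/
structure IsAdjacentDyadicFamily {S : Type*} [MeasurableSpace S] (d : S → S → ℝ)
    (c₀ C₀ δ γ : ℝ) {m : ℕ} (𝒟 : Fin m → ℤ → Set (Set S)) : Prop where
  isDyadicSystem : ∀ j, IsDyadicSystem d c₀ C₀ δ (𝒟 j)
  adjacent : ∀ s ρ, 0 < ρ → ∃ j k, ∃ Q ∈ 𝒟 j k, qball d s ρ ⊆ Q ∧
    ∀ x ∈ Q, ∀ y ∈ Q, d x y ≤ γ * ρ

/-- The admissible range of the parameters of an adjacent family of dyadic systems. -/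
structure AdmissibleParams (c₀ C₀ δ γ : ℝ) : Prop where
  c₀_pos : 0 < c₀
  c₀_le : c₀ ≤ C₀
  δ_pos : 0 < δ
  δ_lt_one : δ < 1
  one_le_γ : 1 ≤ γ

/-- `𝒮` is `η`-sparse. -/
def IsSparse {S : Type*} [MeasurableSpace S] (μ : Measure S) (η : ℝ) (𝒮 : Set (Set S)) : Prop :=
  ∃ E : Set S → Set S,
    (∀ Q ∈ 𝒮, MeasurableSet (E Q) ∧ E Q ⊆ Q ∧ ENNReal.ofReal η * μ Q ≤ μ (E Q)) ∧
    𝒮.PairwiseDisjoint E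

/-- `f` vanishes outside a set of finite diameter. -/
def BoundedlySupported {S X : Type*} [Zero X] (d : S → S → ℝ) (f : S → X) : Prop :=
  ∃ R : ℝ, ∀ s ∈ Function.support f, ∀ t ∈ Function.support f, d s t ≤ R

/-- The average `⟨‖f‖⟩_{p,Q} = (μ(Q)⁻¹ ∫_Q ‖f‖^p dμ)^{1/p}`. -/
def average {S X : Type*} [MeasurableSpace S] [NormedAddCommGroup X] (μ : Measure S) (p : ℝ)
    (Q : Set S) (f : S → X) : ℝ≥0∞ :=
  ((μ Q)⁻¹ * ∫⁻ s in Q, ‖f s‖ₑ ^ p ∂μ) ^ (1 / p)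

/-- The weak `L^p` quasi-norm `sup_t t μ(g > t)^{1/p}` of a nonnegative function. -/
def weakNorm {S : Type*} [MeasurableSpace S] (μ : Measure S) (p : ℝ) (g : S → ℝ≥0∞) : ℝ≥0∞ :=
  ⨆ t : ℝ≥0, (t : ℝ≥0∞) * μ {s | (t : ℝ≥0∞) < g s} ^ (1 / p)

/-- The norm `‖U‖_{L^p → L^{p,∞}}` of an operator `U` that is given on the domain `dom`: the
infimum of all `A` with `‖U f‖_{L^{p,∞}} ≤ A ‖f‖_{L^p}` for all `f` in `dom`. -/
def weakOpNorm {S X : Type*} [MeasurableSpace S] [NormedAddCommGroup X] (μ : Measure S) (p : ℝ)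
    (dom : Set (S → X)) (U : (S → X) → S → ℝ≥0∞) : ℝ≥0∞ :=
  sInf {A | ∀ f ∈ dom, weakNorm μ p (U f) ≤ A * eLpNorm f (ENNReal.ofReal p) μ}

section Operators

variable {S X Y 𝕜 : Type*} [MeasurableSpace S] [RCLike 𝕜]
  [NormedAddCommGroup X] [NormedSpace 𝕜 X] [NormedAddCommGroup Y] [NormedSpace 𝕜 Y]
  {μ : Measure S} {p₁ : ℝ}

open Classical in
/-- `T f`, for a function `f` in `L^{p₁}(S; X)`; the value outside `L^{p₁}` is never used. -/
def applyFun (T : Lp X (ENNReal.ofReal p₁) μ →ₗ[𝕜] (S →ₘ[μ] Y)) (f : S → X) : S → Y :=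
  if h : MemLp f (ENNReal.ofReal p₁) μ then T (h.toLp f) else 0

/-- The sharp grand maximal truncation operator: the supremum over all balls `B = B(z, ρ)` that
contain `s` of the essential supremum over `(s', s'') ∈ B × B` of
`‖T(f 1_{S ∖ αB})(s') - T(f 1_{S ∖ αB})(s'')‖`, where `αB = B(z, α ρ)`. -/
def sharpMaximal (d : S → S → ℝ) (α : ℝ)
    (T : Lp X (ENNReal.ofReal p₁) μ →ₗ[𝕜] (S →ₘ[μ] Y)) (f : S → X) (s : S) : ℝ≥0∞ :=
  ⨆ (z : S) (ρ : ℝ) (_ : 0 < ρ) (_ : s ∈ qball d z ρ),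
    essSup (fun q : S × S =>
        ‖applyFun T ((qball d z (α * ρ))ᶜ.indicator f) q.1 -
          applyFun T ((qball d z (α * ρ))ᶜ.indicator f) q.2‖ₑ)
      ((μ.restrict (qball d z ρ)).prod (μ.restrict (qball d z ρ)))

/-- `‖T‖_{L^{p₁}(S; X) → L^{p₁,∞}(S; Y)}`. -/
def opNorm (T : Lp X (ENNReal.ofReal p₁) μ →ₗ[𝕜] (S →ₘ[μ] Y)) : ℝ≥0∞ :=
  weakOpNorm μ p₁ {f : S → X | MemLp f (ENNReal.ofReal p₁) μ} fun f s => ‖applyFun T f s‖ₑ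

/-- The norm `L^{p₂}(S; X) → L^{p₂,∞}(S)` of the sharp grand maximal truncation operator, which is
defined on those `f` in `L^{p₂}(S; X)` on which `T` is defined. -/
def sharpMaximalNorm (d : S → S → ℝ) (α p₂ : ℝ)
    (T : Lp X (ENNReal.ofReal p₁) μ →ₗ[𝕜] (S →ₘ[μ] Y)) : ℝ≥0∞ :=
  weakOpNorm μ p₂
    {f : S → X | MemLp f (ENNReal.ofReal p₁) μ ∧ MemLp f (ENNReal.ofReal p₂) μ}
    (sharpMaximal d α T)

/-- `T` is `r`-sublinear with constant `C_r` on disjointly and boundedly supported functions in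
`L^{p₀}(S; X)`. -/
def IsSublinear (d : S → S → ℝ) (p₀ r C_r : ℝ)
    (T : Lp X (ENNReal.ofReal p₁) μ →ₗ[𝕜] (S →ₘ[μ] Y)) : Prop :=
  ∀ (n : ℕ) (f : Fin n → S → X),
    (∀ k, MemLp (f k) (ENNReal.ofReal p₀) μ) →
    (∀ k, BoundedlySupported d (f k)) →
    (∀ k l, k ≠ l → Disjoint (Function.support (f k)) (Function.support (f l))) →
    ∀ᵐ s ∂μ, ‖applyFun T (∑ k, f k) s‖ ≤ C_r * (∑ k, ‖applyFun T (f k) s‖ ^ r) ^ (1 / r)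

end Operators

end SparseDom

end

open SparseDom

namespace SparseDom

/-! ### Quasi-metrics, doubling, σ-finiteness -/

section Basics

variable {S : Type*} {d : S → S → ℝ} {c_d : ℝ}

/-! Dyadic systems. Doubling bounds the number of `ε * ρ`-separated points in a ball of radius `ρ`.
Hence at every scale a bounded number of `ρ`-nets has a union that is even `ε * ρ`-dense
(`exists_nets`). Take one net per scale and join every net point to a parent in the next coarser
net. Each point `s` of the space is assigned, measurably, a branch of this tree that stays close to
`s` at all scales (`exists_coherentProjection`); the fibres of the assignment are the cubes. A ball
whose centre is very close to a net point lies in the cube of that point, and by the density of the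
union every ball has this property for one of the systems.

Sparse domination. Work with the cubes of a single system and write `W Q` for the dilated ball of
`Q`. Let `g` be supported in `W Q`. By the two weak-type bounds, `T g` and the sharp maximal
function of `g` exceed a large multiple of the average of `g` over `W Q` only on a small part of
`Q`. Put that part into an open set `U` that is still small in `Q`, and stop at the maximal subcubes
`P` in which `U` has a large density. They fill at most half of `Q`, and off them `T g` obeys the
bound. `U` does not fill most of `P`, so there is a good point in `P`, where `T (g 1_{W P}ᶜ) = T g -
T (g 1_{W P})` is under control; the sharp maximal function carries this bound to almost all of `P`
(`exists_stopping_family`). Continue in `P` with `g 1_{W P}`.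

Iteration yields chains of cubes. Almost every point is left over after finitely many steps, and
along its chain `f` splits into disjointly supported pieces, each controlled by averages over two
consecutive `W`'s. The `r`-sublinearity of `T` adds them up (`sum_pieces_add_le`). Finally each `W
P` is replaced by a comparable cube of an adjacent system, which is the only use of the other
systems. The parts left over by the chains are disjoint and witness sparseness
(`IsStoppingRule.isSparse`). All constants are made linear in the factors that carry exponents `1/p`
or `1/r`, so that they do not depend on `p₁`, `p₂`, `r`. -/

lemma IsQuasiMetric.self_eq_zero (h : IsQuasiMetric d c_d) (s : S) : d s s = 0 :=
  (h.eq_zero_iff s s).2 rfl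

lemma IsQuasiMetric.pos (h : IsQuasiMetric d c_d) : 0 < c_d := one_pos.trans_le h.one_le

lemma IsQuasiMetric.mem_qball_self (h : IsQuasiMetric d c_d) (s : S) {ρ : ℝ} (hρ : 0 < ρ) :
    s ∈ qball d s ρ := by
  simpa [qball, h.self_eq_zero] using hρ

lemma qball_mono (s : S) {ρ ρ' : ℝ} (h : ρ ≤ ρ') : qball d s ρ ⊆ qball d s ρ' :=
  fun _ ht => lt_of_lt_of_le ht h

lemma IsQuasiMetric.triangle_lt (h : IsQuasiMetric d c_d) {s t u : S} {a b : ℝ}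
    (h₁ : d s u < a) (h₂ : d u t < b) : d s t < c_d * (a + b) :=
  (h.quasi_triangle s t u).trans_lt (mul_lt_mul_of_pos_left (add_lt_add h₁ h₂) h.pos)

/-- The constant by which the measure of a ball grows when its radius is multiplied by `L`. -/
noncomputable def doublingConst (c_μ L : ℝ) : ℝ≥0 := max 1 c_μ.toNNReal ^ ⌈L⌉₊

lemma one_le_doublingConst (c_μ L : ℝ) : 1 ≤ doublingConst c_μ L :=
  one_le_pow₀ (le_max_left _ _)

variable [MeasurableSpace S] {μ : Measure S} {c_μ : ℝ}

lemma IsHomogeneousType.measure_qball_mul_le (hS : IsHomogeneousType d μ c_d c_μ) (s : S)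
    (L : ℝ) {ρ : ℝ} (hρ : 0 < ρ) :
    μ (qball d s (L * ρ)) ≤ doublingConst c_μ L * μ (qball d s ρ) := by
  have key : ∀ n : ℕ, μ (qball d s (2 ^ n * ρ)) ≤
      ((max 1 c_μ.toNNReal ^ n : ℝ≥0) : ℝ≥0∞) * μ (qball d s ρ) := by
    intro n
    induction n with
    | zero => simp
    | succ n ih =>
      calc μ (qball d s (2 ^ (n + 1) * ρ)) = μ (qball d s (2 * (2 ^ n * ρ))) := by
            congr 2; ring
        _ ≤ ENNReal.ofReal c_μ * μ (qball d s (2 ^ n * ρ)) := hS.doubling _ _ (by positivity)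
        _ ≤ ((max 1 c_μ.toNNReal : ℝ≥0) : ℝ≥0∞) *
            (((max 1 c_μ.toNNReal ^ n : ℝ≥0) : ℝ≥0∞) * μ (qball d s ρ)) := by
            gcongr
            exact ENNReal.coe_le_coe.2 (le_max_right _ _)
        _ = _ := by rw [← mul_assoc, ← ENNReal.coe_mul, pow_succ']
  refine (measure_mono (qball_mono s ?_)).trans (key ⌈L⌉₊)
  gcongr
  exact (Nat.le_ceil L).trans (by exact_mod_cast Nat.lt_two_pow_self.le)

lemma IsHomogeneousType.sigmaFinite (hS : IsHomogeneousType d μ c_d c_μ) : SigmaFinite μ := by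
  rcases isEmpty_or_nonempty S with hE | ⟨⟨s⟩⟩
  · have : μ = 0 := Measure.eq_zero_of_isEmpty μ
    rw [this]; infer_instance
  · refine ⟨⟨⟨fun n : ℕ => qball d s (n + 1), fun _ => trivial,
      fun n => hS.ball_lt_top _ _ (by positivity), ?_⟩⟩⟩
    refine eq_univ_of_forall fun t => mem_iUnion.2 ?_
    obtain ⟨n, hn⟩ := exists_nat_gt (d s t)
    exact ⟨n, hn.trans (by simp)⟩

lemma countable_of_pairwiseDisjoint_measure_pos [SigmaFinite μ] {ι : Type*} {A : Set ι}
    (B : ι → Set S)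
    (hm : ∀ i ∈ A, MeasurableSet (B i)) (hpos : ∀ i ∈ A, 0 < μ (B i))
    (hd : A.PairwiseDisjoint B) : A.Countable := by
  have h := Measure.countable_meas_pos_of_disjoint_iUnion (μ := μ) (As := fun i : A => B i)
    (fun i => hm i i.2) (fun i j hij => hd i.2 j.2 (Subtype.coe_injective.ne hij))
  have h2 : {i : A | 0 < μ (B i)} = univ := eq_univ_of_forall fun i => hpos i i.2
  rw [h2] at h
  exact countable_coe_iff.1 (countable_univ_iff.1 h)

end Basics

/-! ### Separated sets and nets -/

section Nets

variable {S : Type*} {d : S → S → ℝ} {c_d : ℝ}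

/-- The points of `N` have mutual distances at least `ρ`. -/
def IsSep (d : S → S → ℝ) (ρ : ℝ) (N : Set S) : Prop :=
  ∀ x ∈ N, ∀ y ∈ N, x ≠ y → ρ ≤ d x y

/-- `N` is a `ρ`-separated and `ρ`-dense set. -/
structure IsNet (d : S → S → ℝ) (ρ : ℝ) (N : Set S) : Prop where
  sep : IsSep d ρ N
  cover : ∀ s, ∃ x ∈ N, d s x < ρ

/-- Zorn's lemma; maximality forces density. Starting from a given `Y` permits enlarging a partial
separated set to a net. -/
lemma IsQuasiMetric.exists_maximal_sep (h : IsQuasiMetric d c_d) {ρ : ℝ} (hρ : 0 < ρ)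
    {A Y : Set S} (hYA : Y ⊆ A) (hY : IsSep d ρ Y) :
    ∃ N, Y ⊆ N ∧ N ⊆ A ∧ IsSep d ρ N ∧ ∀ a ∈ A, ∃ x ∈ N, d a x < ρ := by
  obtain ⟨N, hYN, hN⟩ := zorn_subset_nonempty {N : Set S | N ⊆ A ∧ IsSep d ρ N} (by
    intro c hc hchain _
    refine ⟨⋃₀ c, ⟨sUnion_subset fun s hs => (hc hs).1, ?_⟩, fun s => subset_sUnion_of_mem⟩
    rintro x ⟨s, hs, hxs⟩ y ⟨t, ht, hyt⟩ hxy
    rcases hchain.total hs ht with hst | hts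
    · exact (hc ht).2 x (hst hxs) y hyt hxy
    · exact (hc hs).2 x hxs y (hts hyt) hxy) Y ⟨hYA, hY⟩
  refine ⟨N, hYN, hN.prop.1, hN.prop.2, fun a ha => ?_⟩
  by_contra! hcon
  have hins : insert a N ∈ {N : Set S | N ⊆ A ∧ IsSep d ρ N} := by
    refine ⟨insert_subset ha hN.prop.1, ?_⟩
    rintro x (rfl | hx) y (rfl | hy) hxy
    · exact absurd rfl hxy
    · exact hcon y hy
    · rw [h.symm]; exact hcon x hx
    · exact hN.prop.2 x hx y hy hxy
  have haN : a ∈ N := hN.le_of_ge hins (subset_insert a N) (mem_insert a N)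
  have := hcon a haN
  rw [h.self_eq_zero] at this
  exact absurd this (not_le.2 hρ)

lemma isSep_empty (ρ : ℝ) : IsSep d ρ (∅ : Set S) := fun _ hx => hx.elim

lemma IsQuasiMetric.disjoint_qball (h : IsQuasiMetric d c_d) {x y : S} {ρ : ℝ}
    (hxy : 2 * c_d * ρ ≤ d x y) : Disjoint (qball d x ρ) (qball d y ρ) := by
  refine Set.disjoint_left.2 fun t htx hty => ?_
  have h2 : d t y < ρ := by rw [h.symm]; exact hty
  have := h.triangle_lt (show d x t < ρ from htx) h2
  linarith

variable [MeasurableSpace S] {μ : Measure S} {c_μ : ℝ}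

lemma IsHomogeneousType.countable_of_isSep (hS : IsHomogeneousType d μ c_d c_μ) {ρ : ℝ}
    (hρ : 0 < ρ) {N : Set S} (hN : IsSep d ρ N) : N.Countable := by
  have := hS.sigmaFinite
  have hc := hS.isQuasiMetric.pos
  have hr : 0 < ρ / (2 * c_d) := by positivity
  refine countable_of_pairwiseDisjoint_measure_pos (μ := μ) (fun x => qball d x (ρ / (2 * c_d)))
    (fun x _ => hS.measurableSet_ball _ _ hr) (fun x _ => hS.ball_pos _ _ hr) ?_
  intro x hx y hy hxy
  refine hS.isQuasiMetric.disjoint_qball ?_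
  rw [mul_div_cancel₀ _ (by positivity)]
  exact hN x hx y hy hxy

/-- A bound for the number of `ε * ρ`-separated points in a ball of radius `ρ`. -/
noncomputable def packingBound (c_d c_μ ε : ℝ) : ℕ :=
  ⌈((doublingConst c_μ (4 * c_d ^ 2 / ε) * doublingConst c_μ (c_d * (1 + ε)) : ℝ≥0) : ℝ)⌉₊

/-- Volume comparison: the balls of radius `ε * ρ / (2 * c_d)` around the points are disjoint, lie
in a fixed multiple of `B(s, ρ)`, and each has at least a fixed fraction of its measure. -/
lemma IsHomogeneousType.card_le_packingBound (hS : IsHomogeneousType d μ c_d c_μ) {ε ρ : ℝ}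
    (hε : 0 < ε) (hρ : 0 < ρ) (s : S) {m : ℕ} (y : Fin m → S) (hy : ∀ i, d s (y i) < ρ)
    (hsep : ∀ i j, i ≠ j → ε * ρ ≤ d (y i) (y j)) : m ≤ packingBound c_d c_μ ε := by
  have hq := hS.isQuasiMetric
  have hc := hq.pos
  have hc1 := hq.one_le
  set r : ℝ := ε * ρ / (2 * c_d) with hr
  have hr0 : 0 < r := by positivity
  have hdisj : Pairwise (Function.onFun Disjoint fun i => qball d (y i) r) := by
    intro i j hij
    refine hq.disjoint_qball ?_
    rw [hr, mul_div_cancel₀ _ (by positivity)]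
    exact hsep i j hij
  have h1 : ∀ i, μ (qball d s ρ) ≤
      doublingConst c_μ (4 * c_d ^ 2 / ε) * μ (qball d (y i) r) := by
    intro i
    refine le_trans (measure_mono ?_) (hS.measure_qball_mul_le (y i) _ hr0)
    intro t ht
    have h2 : d (y i) s < ρ := by rw [hq.symm]; exact hy i
    have := hq.triangle_lt h2 (show d s t < ρ from ht)
    refine lt_of_lt_of_eq this ?_
    rw [hr]; field_simp; ring
  have h2 : ∑ i, μ (qball d (y i) r) ≤
      doublingConst c_μ (c_d * (1 + ε)) * μ (qball d s ρ) := by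
    rw [← tsum_fintype (L := .unconditional _),
      ← measure_iUnion hdisj fun i => hS.measurableSet_ball _ _ hr0]
    refine le_trans (measure_mono ?_) (hS.measure_qball_mul_le s _ hρ)
    refine iUnion_subset fun i t ht => ?_
    refine (hq.triangle_lt (hy i) ht).trans_le ?_
    rw [mul_assoc, add_mul, one_mul]
    gcongr
    rw [hr, div_le_iff₀ (by positivity)]
    nlinarith [mul_pos hε hρ]
  have h3 : (m : ℝ≥0∞) * μ (qball d s ρ) ≤
      (doublingConst c_μ (4 * c_d ^ 2 / ε) * doublingConst c_μ (c_d * (1 + ε)) : ℝ≥0) *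
        μ (qball d s ρ) := by
    calc (m : ℝ≥0∞) * μ (qball d s ρ) = ∑ _i : Fin m, μ (qball d s ρ) := by simp
      _ ≤ ∑ i : Fin m, doublingConst c_μ (4 * c_d ^ 2 / ε) * μ (qball d (y i) r) :=
          Finset.sum_le_sum fun i _ => h1 i
      _ ≤ doublingConst c_μ (4 * c_d ^ 2 / ε) *
          (doublingConst c_μ (c_d * (1 + ε)) * μ (qball d s ρ)) := by
          rw [← Finset.mul_sum]; gcongr
      _ = _ := by rw [ENNReal.coe_mul, mul_assoc]
  rw [ENNReal.mul_le_mul_iff_left (hS.ball_pos s ρ hρ).ne' (hS.ball_lt_top s ρ hρ).ne] at h3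
  have h4 : (m : ℝ≥0) ≤
      doublingConst c_μ (4 * c_d ^ 2 / ε) * doublingConst c_μ (c_d * (1 + ε)) := by
    exact_mod_cast h3
  have h5 : (m : ℝ) ≤ ((doublingConst c_μ (4 * c_d ^ 2 / ε) *
      doublingConst c_μ (c_d * (1 + ε)) : ℝ≥0) : ℝ) := by
    exact_mod_cast h4
  exact_mod_cast h5.trans (Nat.le_ceil _)

/-- Each net takes care of points that are `ε * ρ`-far from what was selected before. A point missed
by all nets would have, within `ρ`, one selected point per net, and these are mutually `ε *
ρ`-separated: one more than the packing bound allows. -/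
lemma IsHomogeneousType.exists_nets (hS : IsHomogeneousType d μ c_d c_μ) {ε ρ : ℝ}
    (hε : 0 < ε) (hρ : 0 < ρ) :
    ∃ N : Fin (packingBound c_d c_μ ε + 1) → Set S, (∀ j, IsNet d ρ (N j)) ∧
      ∀ s, ∃ j, ∃ x ∈ N j, d s x < ε * ρ := by
  have hq := hS.isQuasiMetric
  have hmax : ∀ A : Set S, ∃ N ⊆ A, IsSep d ρ N ∧ ∀ a ∈ A, ∃ x ∈ N, d a x < ρ := by
    intro A
    obtain ⟨N, -, h⟩ := hq.exists_maximal_sep hρ (empty_subset A) (isSep_empty ρ)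
    exact ⟨N, h⟩
  choose M hMA hMsep hMcov using hmax
  let far : Set S → Set S := fun U => {s | ∀ y ∈ U, ε * ρ ≤ d s y}
  let U : ℕ → Set S := fun n => Nat.rec ∅ (fun _ V => V ∪ M (far V)) n
  have hUmono : Monotone U := monotone_nat_of_le_succ fun n => subset_union_left
  have hext : ∀ j, ∃ N, M (far (U j)) ⊆ N ∧ IsNet d ρ N := by
    intro j
    obtain ⟨N, h1, -, h2, h3⟩ := hq.exists_maximal_sep hρ (subset_univ _) (hMsep (far (U j)))
    exact ⟨N, h1, h2, fun s => h3 s (mem_univ s)⟩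
  choose N hMN hN using hext
  refine ⟨fun j => N j, fun j => hN j, fun s => ?_⟩
  by_contra! hcon
  have hfar : ∀ j ≤ packingBound c_d c_μ ε + 1, s ∈ far (U j) := by
    intro j
    induction j with
    | zero => intro _ y hy; exact hy.elim
    | succ j ih =>
      rintro hj y (hy | hy)
      · exact ih (by omega) y hy
      · exact hcon ⟨j, by omega⟩ y (hMN j hy)
  have hex : ∀ j : Fin (packingBound c_d c_μ ε + 1), ∃ y ∈ M (far (U j)), d s y < ρ :=
    fun j => hMcov _ s (hfar j j.2.le)
  choose y hyM hy using hex
  have hlt : ∀ i j, i < j → ε * ρ ≤ d (y j) (y i) := fun i j hij =>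
    hMA _ (hyM j) (y i) (hUmono (Nat.succ_le_of_lt hij) (Or.inr (hyM i)))
  have := hS.card_le_packingBound hε hρ s y hy (fun i j hij => by
    rcases lt_or_gt_of_ne hij with h | h
    · rw [hq.symm]; exact hlt i j h
    · exact hlt j i h)
  omega

lemma IsHomogeneousType.finite_of_isSep (hS : IsHomogeneousType d μ c_d c_μ) {ρ L : ℝ}
    (hρ : 0 < ρ) (hL : 0 < L) {N : Set S} (hN : IsSep d ρ N) (s : S) :
    {x ∈ N | d s x < L * ρ}.Finite := by
  by_contra hinf
  obtain ⟨t, ht, hcard⟩ := (Set.not_finite.1 hinf : Set.Infinite _).exists_subset_card_eq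
    (packingBound c_d c_μ (1 / L) + 1)
  have hle := hS.card_le_packingBound (ε := 1 / L) (ρ := L * ρ) (by positivity) (by positivity) s
    (fun i => (t.equivFin.symm i : S)) (fun i => (ht (t.equivFin.symm i).2).2) (fun i j hij => by
      rw [← mul_assoc, one_div_mul_cancel hL.ne', one_mul]
      refine hN _ (ht (t.equivFin.symm i).2).1 _ (ht (t.equivFin.symm j).2).1 ?_
      exact fun h => hij (t.equivFin.symm.injective (Subtype.coe_injective h)))
  omega

end Nets

/-! ### Compactness and measurable selection -/

section Selection

/-- The finite form of König's lemma: if every candidate failed at some stage, all of them would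
fail at the largest of these finitely many stages. -/
lemma exists_forall_of_antitone {ι : Type*} {F : Set ι} (hF : F.Finite) {R : ℕ → ι → Prop}
    (hR : ∀ m w, R (m + 1) w → R m w) (h : ∀ m, ∃ w ∈ F, R m w) : ∃ w ∈ F, ∀ m, R m w := by
  have hR' : ∀ w m n, m ≤ n → R n w → R m w := by
    intro w m n hmn
    induction n, hmn using Nat.le_induction with
    | base => exact id
    | succ n _ ih => exact fun hw => ih (hR n w hw)
  by_contra! hcon
  have hcon' : ∀ w, ∃ m, w ∈ F → ¬ R m w := fun w => by
    by_cases hw : w ∈ F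
    · obtain ⟨m, hm⟩ := hcon w hw
      exact ⟨m, fun _ => hm⟩
    · exact ⟨0, fun h => absurd h hw⟩
  choose m hm using hcon'
  obtain ⟨b, hb⟩ := (hF.image m).bddAbove
  obtain ⟨w, hwF, hw⟩ := h b
  exact hm w hwF (hR' w _ _ (hb (mem_image_of_mem m hwF)) hw)

/-- Take the admissible index that comes first in an enumeration of `N`. -/
lemma exists_measurable_selection {S ι : Type*} [MeasurableSpace S] {N : Set ι} (hN : N.Countable)
    {G : ι → S → Prop} (hG : ∀ s, ∃ w ∈ N, G w s) (hm : ∀ w ∈ N, MeasurableSet {s | G w s}) :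
    ∃ f : S → ι, (∀ s, f s ∈ N) ∧ (∀ s, G (f s) s) ∧ ∀ w, MeasurableSet {s | f s = w} := by
  obtain ⟨e, he⟩ := countable_iff_exists_injOn.1 hN
  have hmin : ∀ s, ∃ w, (w ∈ N ∧ G w s) ∧ ∀ w', w' ∈ N → G w' s → e w ≤ e w' := by
    intro s
    have hne : (e '' {w | w ∈ N ∧ G w s}).Nonempty := by
      obtain ⟨w, hw⟩ := hG s
      exact ⟨e w, w, hw, rfl⟩
    obtain ⟨w, hw, hwe⟩ := Nat.sInf_mem hne
    exact ⟨w, hw, fun w' h1 h2 => hwe.trans_le (Nat.sInf_le ⟨w', ⟨h1, h2⟩, rfl⟩)⟩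
  choose f hf hfmin using hmin
  refine ⟨f, fun s => (hf s).1, fun s => (hf s).2, fun w => ?_⟩
  by_cases hw : w ∈ N
  · have heq : {s | f s = w} =
        {s | G w s} ∩ ⋂ w' ∈ {w' ∈ N | e w' < e w}, {s | G w' s}ᶜ := by
      ext s
      simp only [mem_ofPred_eq, mem_inter_iff, mem_iInter, mem_compl_iff]
      constructor
      · rintro rfl
        exact ⟨(hf s).2, fun w' hw' h => absurd (hfmin s w' hw'.1 h) (not_le.2 hw'.2)⟩
      · rintro ⟨h1, h2⟩
        refine he (hf s).1 hw (le_antisymm (hfmin s w hw h1) ?_)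
        by_contra! hlt
        exact h2 (f s) ⟨(hf s).1, hlt⟩ (hf s).2
    rw [heq]
    exact (hm w hw).inter (MeasurableSet.biInter (hN.mono (sep_subset _ _))
      fun w' hw' => (hm w' hw'.1).compl)
  · convert MeasurableSet.empty
    refine eq_empty_of_forall_notMem fun s hs => hw ?_
    rw [← show f s = w from hs]
    exact (hf s).1

end Selection

/-! ### Construction of adjacent dyadic systems -/

section Projections

variable {S : Type*} {d : S → S → ℝ} {c_d : ℝ}

/-- The ancestor of generation `k` of a point of generation `k + m`. -/
def ancestor (par : ℤ → S → S) (k : ℤ) : ℕ → S → S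
  | 0, v => v
  | m + 1, v => ancestor par k m (par (k + m) v)

/-- The definition peels off the finest step of the descent, this identity the coarsest one; the
latter is needed to pass from a point to one of its children. -/
lemma ancestor_succ (par : ℤ → S → S) (k : ℤ) (m : ℕ) (v : S) :
    ancestor par k (m + 1) v = par k (ancestor par (k + 1) m v) := by
  induction m generalizing v with
  | zero => simp [ancestor]
  | succ m ih =>
    rw [ancestor, ih, ancestor, Nat.cast_add, Nat.cast_one, add_right_comm, add_assoc k]

/-- By separation at most one net point is within `ρ / (2 * c_d)` of `w`; if there is one, it must
be the parent. This is what gives cubes an inner ball. -/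
lemma IsQuasiMetric.exists_parent (h : IsQuasiMetric d c_d) {ρ : ℝ} {N : Set S}
    (hN : IsNet d ρ N) (w : S) :
    ∃ x ∈ N, d w x < ρ ∧ ∀ z ∈ N, d w z < ρ / (2 * c_d) → x = z := by
  have hc := h.pos
  by_cases hz : ∃ z ∈ N, d w z < ρ / (2 * c_d)
  · obtain ⟨z, hzN, hz⟩ := hz
    refine ⟨z, hzN, hz.trans_le ?_, fun z' hz' hlt => ?_⟩
    · have h1 := h.one_le
      have hρ : 0 < ρ / (2 * c_d) := (h.nonneg _ _).trans_lt hz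
      have h2 : ρ / (2 * c_d) * (2 * c_d) = ρ := div_mul_cancel₀ _ (by positivity)
      nlinarith
    · by_contra hne
      have h1 := hN.sep z hzN z' hz' hne
      rw [h.symm] at hz
      have h2 := h.triangle_lt hz hlt
      have h3 : c_d * (ρ / (2 * c_d) + ρ / (2 * c_d)) = ρ := by field_simp; ring
      linarith
  · obtain ⟨x, hx, hlt⟩ := hN.cover w
    exact ⟨x, hx, hlt, fun z hzN hlt => absurd ⟨z, hzN, hlt⟩ hz⟩

variable [MeasurableSpace S] {μ : Measure S} {c_μ : ℝ}

/-- Measurable maps onto nets, one for each generation, such that each of them is a function of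
the next one. -/
structure IsCoherentProjection (d : S → S → ℝ) (c_d δ : ℝ) (N : ℤ → Set S) (π : ℤ → S → S) :
    Prop where
  mem : ∀ k s, π k s ∈ N k
  dist_lt : ∀ k s, d s (π k s) < 2 * c_d * δ ^ k
  eq_of_dist_lt : ∀ k s, ∀ z ∈ N k, d z s < 1 / (4 * c_d ^ 2) * δ ^ k → π k s = z
  measurableSet : ∀ k z, MeasurableSet {s | π k s = z}
  coherent : ∀ k s t, π (k + 1) s = π (k + 1) t → π k s = π k t

lemma IsHomogeneousType.exists_coherentProjection (hS : IsHomogeneousType d μ c_d c_μ)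
    {δ : ℝ} (hδ : 0 < δ) (hδc : 8 * c_d ^ 3 * δ ≤ 1) {N : ℤ → Set S}
    (hN : ∀ k, IsNet d (δ ^ k) (N k)) : ∃ π, IsCoherentProjection d c_d δ N π := by
  have hq := hS.isQuasiMetric
  have hc := hq.pos
  have hc1 := hq.one_le
  have hpow : ∀ k : ℤ, 0 < δ ^ k := fun k => zpow_pos hδ k
  have hsucc : ∀ k : ℤ, δ ^ (k + 1) = δ ^ k * δ := fun k => zpow_add_one₀ hδ.ne' k
  -- The error `2 * c_d * δ ^ (k + 1)` of the projection at generation `k + 1` fits into the inner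
  -- radius at generation `k`.
  have hδ1 : 2 * c_d * δ ≤ 1 / (4 * c_d ^ 2) := by
    rw [le_div_iff₀ (by positivity)]
    linarith
  have hδ2 : 1 / (4 * c_d ^ 2) ≤ 1 := by
    rw [div_le_one (by positivity)]
    nlinarith
  have hcount : ∀ k, (N k).Countable := fun k => hS.countable_of_isSep (hpow k) (hN k).sep
  choose par hparN hpar hparz using fun k w => hq.exists_parent (hN k) w
  let V : ℤ → S → Set S := fun k s => {v ∈ N k | d s v < 2 * c_d * δ ^ k}
  have hVfin : ∀ k s, (V k s).Finite := fun k s =>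
    hS.finite_of_isSep (hpow k) (by positivity) (hN k).sep s
  have hVpar : ∀ k s v, v ∈ V (k + 1) s → par k v ∈ V k s := by
    intro k s v hv
    refine ⟨hparN k v, (hq.triangle_lt hv.2 (hpar k v)).trans_le ?_⟩
    rw [hsucc]
    have := hpow k
    nlinarith [mul_le_mul_of_nonneg_left (hδ1.trans hδ2) (mul_pos hc this).le]
  have hVne : ∀ k s, (V k s).Nonempty := by
    intro k s
    obtain ⟨v, hv, hlt⟩ := (hN k).cover s
    refine ⟨v, hv, hlt.trans_le ?_⟩
    nlinarith [hpow k]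
  -- `R k m w s`: some descendant of `w`, `m` generations further down, is close to `s`. `G k w s`
  -- asks this for all `m`, so that by finiteness of `V` a whole branch below `w` stays close to
  -- `s`. As a countable combination of balls, `G` is measurable in `s`.
  let R : ℤ → ℕ → S → S → Prop := fun k m w s => ∃ v ∈ V (k + m) s, ancestor par k m v = w
  let G : ℤ → S → S → Prop := fun k w s => ∀ m, R k m w s
  have hRsucc : ∀ k m w s, R k (m + 1) w s → R k m w s := by
    rintro k m w s ⟨v, hv, hvw⟩
    refine ⟨par (k + m) v, hVpar _ _ _ ?_, hvw⟩
    rwa [Nat.cast_add, Nat.cast_one, ← add_assoc] at hv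
  have hGV : ∀ k w s, G k w s → w ∈ V k s := by
    intro k w s h
    obtain ⟨v, hv, hvw⟩ := h 0
    rw [Nat.cast_zero, add_zero] at hv
    rwa [← show v = w from hvw]
  have hRV : ∀ k m w s, R k m w s → w ∈ V k s := by
    intro k m w s h
    induction m with
    | zero =>
      obtain ⟨v, hv, hvw⟩ := h
      rw [Nat.cast_zero, add_zero] at hv
      rwa [← show v = w from hvw]
    | succ m ih => exact ih (hRsucc _ _ _ _ h)
  have hGm : ∀ k w, MeasurableSet {s | G k w s} := by
    intro k w
    have : {s | G k w s} = ⋂ m : ℕ, ⋃ v ∈ {v ∈ N (k + m) | ancestor par k m v = w},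
        qball d v (2 * c_d * δ ^ (k + m : ℤ)) := by
      ext s
      simp only [G, R, V, mem_ofPred_eq, mem_iInter, mem_iUnion, qball, exists_prop]
      refine forall_congr' fun m => exists_congr fun v => ?_
      rw [hq.symm s v]; tauto
    rw [this]
    exact MeasurableSet.iInter fun m => MeasurableSet.biUnion ((hcount _).mono (sep_subset _ _))
      fun v _ => hS.measurableSet_ball _ _ (mul_pos (by positivity) (hpow _))
  have hbase : ∀ k s, ∃ w ∈ N k, G k w s := by
    intro k s
    obtain ⟨w, hw, h⟩ := exists_forall_of_antitone (hVfin k s) (R := fun m w => R k m w s)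
      (fun m w => hRsucc k m w s) (fun m => by
        obtain ⟨v, hv⟩ := hVne (k + m) s
        exact ⟨_, hRV k m _ s ⟨v, hv, rfl⟩, v, hv, rfl⟩)
    exact ⟨w, hw.1, h⟩
  have hchild : ∀ k w s, G k w s → ∃ w' ∈ N (k + 1), par k w' = w ∧ G (k + 1) w' s := by
    intro k w s hw
    obtain ⟨w', hw', h⟩ := exists_forall_of_antitone (hVfin (k + 1) s)
      (R := fun m w' => par k w' = w ∧ R (k + 1) m w' s)
      (fun m w' h => ⟨h.1, hRsucc _ _ _ _ h.2⟩) (fun m => by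
        obtain ⟨v, hv, hvw⟩ := hw (m + 1)
        rw [ancestor_succ] at hvw
        rw [show k + ((m + 1 : ℕ) : ℤ) = k + 1 + m by push_cast; ring] at hv
        exact ⟨_, hRV _ _ _ _ ⟨v, hv, rfl⟩, hvw, v, hv, rfl⟩)
    exact ⟨w', hw'.1, (h 0).1, fun m => (h m).2⟩
  let P : ℤ → (S → S) → Prop := fun k f =>
    (∀ s, f s ∈ N k) ∧ (∀ s, f s ∈ V k s) ∧ (∀ w, MeasurableSet {s | f s = w})
  have hdown : ∀ k f, P (k + 1) f → P k fun s => par k (f s) := by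
    rintro k f ⟨h1, h2, h3⟩
    refine ⟨fun s => hparN _ _, fun s => hVpar _ _ _ (h2 s), fun w => ?_⟩
    have : {s | par k (f s) = w} = ⋃ v ∈ {v ∈ N (k + 1) | par k v = w}, {s | f s = v} := by
      ext s
      simp only [mem_ofPred_eq, mem_iUnion, exists_prop]
      exact ⟨fun h => ⟨f s, ⟨h1 s, h⟩, rfl⟩, fun ⟨v, hv, hs⟩ => hs ▸ hv.2⟩
    rw [this]
    exact MeasurableSet.biUnion ((hcount _).mono (sep_subset _ _)) fun v _ => h3 v
  have hup : ∀ k f, (∀ s, G k (f s) s) ∧ P k f →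
      ∃ f', ((∀ s, G (k + 1) (f' s) s) ∧ P (k + 1) f') ∧ ∀ s, par k (f' s) = f s := by
    rintro k f ⟨hf, -, -, hfm⟩
    obtain ⟨f', h1, h2, h3⟩ := exists_measurable_selection (hcount (k + 1))
      (G := fun w s => par k w = f s ∧ G (k + 1) w s) (fun s => hchild k _ s (hf s))
      (fun w _ => by
        refine MeasurableSet.inter (s₁ := {s | par k w = f s}) ?_ (hGm _ w)
        simp_rw [eq_comm (a := par k w)]
        exact hfm _)
    exact ⟨f', ⟨fun s => (h2 s).2, h1, fun s => hGV _ _ _ (h2 s).2, h3⟩, fun s => (h2 s).1⟩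
  -- Generation `0` is the anchor: `F` descends by choosing children that keep `G`, and `H` ascends
  -- by taking parents, where no choice is left and `G` is not needed.
  obtain ⟨f₀, h₀⟩ : ∃ f₀, (∀ s, G 0 (f₀ s) s) ∧ P 0 f₀ := by
    obtain ⟨f, h1, h2, h3⟩ := exists_measurable_selection (hcount 0) (hbase 0) fun w _ => hGm 0 w
    exact ⟨f, h2, h1, fun s => hGV _ _ _ (h2 s), h3⟩
  choose! up hup₁ hup₂ using hup
  let F : ℕ → S → S := fun n => Nat.rec f₀ (fun n f => up n f) n
  have hF : ∀ n : ℕ, (∀ s, G n (F n s) s) ∧ P n (F n) := by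
    intro n
    induction n with
    | zero => exact h₀
    | succ n ih => exact_mod_cast hup₁ n (F n) ih
  let H : ℕ → S → S := fun n => Nat.rec f₀ (fun n f s => par (-(n + 1 : ℤ)) (f s)) n
  have hH : ∀ n : ℕ, P (-n) (H n) := by
    intro n
    induction n with
    | zero => exact h₀.2
    | succ n ih =>
      have := hdown (-(n + 1 : ℤ)) (H n) (by simpa using ih)
      rwa [Nat.cast_add, Nat.cast_one]
  let π : ℤ → S → S := fun k => match k with
    | Int.ofNat n => F n
    | Int.negSucc n => H (n + 1)
  have hπ : ∀ k, P k (π k) := by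
    rintro (n | n)
    · exact (hF n).2
    · exact hH (n + 1)
  have hπpar : ∀ k s, par k (π (k + 1) s) = π k s := by
    rintro (n | n) s
    · exact hup₂ n (F n) (hF n) s
    · rcases n with _ | n
      · rfl
      · have : (Int.negSucc (n + 1) + 1) = Int.negSucc n := by omega
        rw [this]
        rfl
  refine ⟨π, fun k s => (hπ k).1 s, fun k s => ((hπ k).2.1 s).2, fun k s z hz hlt => ?_,
    fun k z => (hπ k).2.2 z, fun k s t h => by rw [← hπpar, h, hπpar]⟩
  rw [← hπpar]
  refine hparz k _ z hz ?_
  have h1 := ((hπ (k + 1)).2.1 s).2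
  rw [hq.symm] at h1 hlt
  refine (hq.triangle_lt h1 hlt).trans_le ?_
  have := hpow k
  rw [hsucc]
  calc c_d * (2 * c_d * (δ ^ k * δ) + 1 / (4 * c_d ^ 2) * δ ^ k)
      = c_d * (2 * c_d * δ + 1 / (4 * c_d ^ 2)) * δ ^ k := by ring
    _ ≤ c_d * (1 / (4 * c_d ^ 2) + 1 / (4 * c_d ^ 2)) * δ ^ k := by gcongr
    _ = δ ^ k / (2 * c_d) := by field_simp; norm_num

lemma IsCoherentProjection.isDyadicSystem (hq : IsQuasiMetric d c_d) {δ : ℝ}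
    {N : ℤ → Set S} {π : ℤ → S → S} (hπ : IsCoherentProjection d c_d δ N π) :
    IsDyadicSystem d (1 / (4 * c_d ^ 2)) (2 * c_d) δ
      (fun k => {Q | ∃ z ∈ N k, Q = {s | π k s = z}}) := by
  have hcoh : ∀ k (n : ℕ) s t, π (k + n) s = π (k + n) t → π k s = π k t := by
    intro k n s t
    induction n with
    | zero => simp
    | succ n ih =>
      intro h
      refine ih (hπ.coherent _ _ _ ?_)
      rwa [Nat.cast_add, Nat.cast_one, ← add_assoc] at h
  refine ⟨?_, ?_, ?_, ?_, ?_⟩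
  · rintro k _ ⟨z, -, rfl⟩
    exact hπ.measurableSet k z
  · rintro k _ ⟨z, -, rfl⟩ _ ⟨z', -, rfl⟩ hne
    refine Set.disjoint_left.2 fun s hs hs' => hne ?_
    simp only [id, mem_ofPred_eq] at hs hs'
    rw [← hs, ← hs']
  · intro k
    exact eq_univ_of_forall fun s => mem_sUnion.2 ⟨_, ⟨π k s, hπ.mem k s, rfl⟩, rfl⟩
  · rintro k l hlk _ ⟨z, -, rfl⟩ _ ⟨z', -, rfl⟩
    refine or_iff_not_imp_left.2 fun hne t ht => ?_
    obtain ⟨s, hs, hs'⟩ := nonempty_iff_ne_empty.2 hne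
    obtain ⟨n, rfl⟩ := Int.le.dest hlk
    exact (hcoh l n t s (ht.trans hs.symm)).trans hs'
  · rintro k _ ⟨z, hz, rfl⟩
    refine ⟨z, fun s hs => hπ.eq_of_dist_lt k s z hz hs, ?_⟩
    rintro s rfl
    rw [qball, mem_ofPred_eq, hq.symm]
    exact hπ.dist_lt k s

/-- The constant of adjacency of the dyadic systems that are constructed here. -/
noncomputable def adjacencyConst (c_d : ℝ) : ℝ := 256 * c_d ^ 8

theorem IsHomogeneousType.exists_adjacentDyadicFamily (hS : IsHomogeneousType d μ c_d c_μ) :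
    ∃ 𝒟 : Fin (packingBound c_d c_μ (1 / (8 * c_d ^ 3)) + 1) → ℤ → Set (Set S),
      IsAdjacentDyadicFamily d (1 / (4 * c_d ^ 2)) (2 * c_d) (1 / (8 * c_d ^ 3))
        (adjacencyConst c_d) 𝒟 := by
  have hq := hS.isQuasiMetric
  have hc := hq.pos
  have hc1 := hq.one_le
  set δ : ℝ := 1 / (8 * c_d ^ 3) with hδ
  have hδ0 : 0 < δ := by positivity
  have hδc : 8 * c_d ^ 3 * δ = 1 := by rw [hδ]; field_simp
  have hδ1 : δ < 1 := by
    have : 1 ≤ c_d ^ 3 := one_le_pow₀ hc1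
    nlinarith
  choose N hN hdense using fun k : ℤ =>
    hS.exists_nets (ε := δ) (ρ := δ ^ k) hδ0 (zpow_pos hδ0 k)
  choose π hπ using fun j => hS.exists_coherentProjection hδ0 hδc.le (fun k => hN k j)
  refine ⟨_, fun j => (hπ j).isDyadicSystem hq, fun s ρ hρ => ?_⟩
  -- `ρ ≤ δ * δ ^ k` puts the ball into the inner ball of the cube at generation `k`; `ρ > δ ^ (k +
  -- 2)` bounds the diameter of that cube in terms of `ρ`, whence the factor `(8 * c_d ^ 3) ^ 2`.
  obtain ⟨k, hk1, hk2⟩ : ∃ k : ℤ, δ * δ ^ (k + 1) < ρ ∧ ρ ≤ δ * δ ^ k := by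
    obtain ⟨n, hn1, hn2⟩ := exists_mem_Ioc_zpow (x := ρ / δ) (y := δ⁻¹) (by positivity)
      (one_lt_inv₀ hδ0 |>.2 hδ1)
    refine ⟨-(n + 1), ?_, ?_⟩
    · rw [inv_zpow', lt_div_iff₀ hδ0] at hn1
      rw [show -(n + 1) + 1 = -n by ring, mul_comm]
      exact hn1
    · rw [inv_zpow', div_le_iff₀ hδ0] at hn2
      rw [mul_comm]
      exact hn2
  obtain ⟨j, z, hz, hsz⟩ := hdense k s
  have hpk := zpow_pos hδ0 k
  refine ⟨j, k, _, ⟨z, hz, rfl⟩, fun t ht => ?_, ?_⟩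
  · refine (hπ j).eq_of_dist_lt k t z hz ?_
    rw [hq.symm] at hsz
    refine (hq.triangle_lt hsz ht).trans_le ?_
    calc c_d * (δ * δ ^ k + ρ) ≤ c_d * (δ * δ ^ k + δ * δ ^ k) := by gcongr
      _ = 1 / (4 * c_d ^ 2) * δ ^ k := by rw [hδ]; field_simp; norm_num
  · intro x hx y hy
    have h1 := (hπ j).dist_lt k x
    have h2 := (hπ j).dist_lt k y
    rw [hx] at h1
    rw [hy, hq.symm] at h2
    refine (hq.triangle_lt h1 h2).le.trans ?_
    have h3 : c_d * (2 * c_d * δ ^ k + 2 * c_d * δ ^ k) =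
        4 * c_d ^ 2 * (8 * c_d ^ 3) ^ 2 * (δ * δ ^ (k + 1)) := by
      rw [zpow_add_one₀ hδ0.ne']
      calc c_d * (2 * c_d * δ ^ k + 2 * c_d * δ ^ k)
          = 4 * c_d ^ 2 * (1 : ℝ) ^ 2 * δ ^ k := by ring
        _ = 4 * c_d ^ 2 * (8 * c_d ^ 3 * δ) ^ 2 * δ ^ k := by rw [hδc]
        _ = _ := by ring
    rw [h3, adjacencyConst]
    calc 4 * c_d ^ 2 * (8 * c_d ^ 3) ^ 2 * (δ * δ ^ (k + 1))
        = 256 * c_d ^ 8 * (δ * δ ^ (k + 1)) := by ring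
      _ ≤ 256 * c_d ^ 8 * ρ := by gcongr

end Projections

/-! ### Metrizability and outer regularity -/

section OuterRegularity

variable {S : Type*} {d : S → S → ℝ} {c_d : ℝ}

/-- The uniformity of a quasi-metric. -/
abbrev IsQuasiMetric.uniformSpace (h : IsQuasiMetric d c_d) : UniformSpace S :=
  UniformSpace.ofCore <| UniformSpace.Core.mkOfBasis
    { sets := {V | ∃ ε : ℝ, 0 < ε ∧ V = {p : S × S | d p.1 p.2 < ε}}
      nonempty := ⟨_, 1, one_pos, rfl⟩
      inter_sets := by
        rintro _ _ ⟨a, ha, rfl⟩ ⟨b, hb, rfl⟩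
        exact ⟨_, ⟨min a b, lt_min ha hb, rfl⟩, fun p hp =>
          ⟨lt_of_lt_of_le (show d p.1 p.2 < min a b from hp) (min_le_left _ _),
            lt_of_lt_of_le (show d p.1 p.2 < min a b from hp) (min_le_right _ _)⟩⟩ }
    (by
      rintro _ ⟨ε, hε, rfl⟩ x
      simpa [h.self_eq_zero] using hε)
    (by
      rintro _ ⟨ε, hε, rfl⟩
      refine ⟨_, ⟨ε, hε, rfl⟩, fun p hp => ?_⟩
      simpa [h.symm p.2 p.1] using hp)
    (by
      rintro _ ⟨ε, hε, rfl⟩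
      have hc := h.pos
      refine ⟨_, ⟨ε / (2 * c_d), by positivity, rfl⟩, ?_⟩
      rintro ⟨x, y⟩ ⟨z, hxz, hzy⟩
      refine (h.triangle_lt hxz hzy).trans_eq ?_
      field_simp
      norm_num)

lemma IsQuasiMetric.mem_uniformity (h : IsQuasiMetric d c_d) (V : Set (S × S)) :
    V ∈ @uniformity S h.uniformSpace ↔ ∃ ε : ℝ, 0 < ε ∧ {p : S × S | d p.1 p.2 < ε} ⊆ V := by
  change V ∈ FilterBasis.filter _ ↔ _
  rw [FilterBasis.mem_filter_iff]
  constructor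
  · rintro ⟨_, ⟨ε, hε, rfl⟩, hV⟩
    exact ⟨ε, hε, hV⟩
  · rintro ⟨ε, hε, hV⟩
    exact ⟨_, ⟨ε, hε, rfl⟩, hV⟩

lemma IsQuasiMetric.isOpen_iff (h : IsQuasiMetric d c_d) (U : Set S) :
    @IsOpen S h.uniformSpace.toTopologicalSpace U ↔ @IsOpen S (qtopology d) U := by
  let := h.uniformSpace
  rw [isOpen_uniformity]
  refine forall₂_congr fun s _ => ?_
  rw [h.mem_uniformity]
  refine exists_congr fun ε => and_congr_right fun _ => ?_
  constructor
  · intro hV t ht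
    exact hV (show (s, t) ∈ {p : S × S | d p.1 p.2 < ε} from ht) rfl
  · rintro hV ⟨x, t⟩ ht rfl
    exact hV ht

lemma IsQuasiMetric.toTopologicalSpace_uniformSpace (h : IsQuasiMetric d c_d) :
    h.uniformSpace.toTopologicalSpace = qtopology d :=
  TopologicalSpace.ext (funext fun U => propext (h.isOpen_iff U))

lemma IsQuasiMetric.isCountablyGenerated_uniformity (h : IsQuasiMetric d c_d) :
    (@uniformity S h.uniformSpace).IsCountablyGenerated := by
  let := h.uniformSpace
  have hb : (uniformity S).HasBasis (fun _ : ℕ => True)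
      fun n => {p : S × S | d p.1 p.2 < 1 / (n + 1 : ℝ)} := by
    refine ⟨fun V => ?_⟩
    rw [h.mem_uniformity]
    constructor
    · rintro ⟨ε, hε, hV⟩
      obtain ⟨n, hn⟩ := exists_nat_one_div_lt hε
      exact ⟨n, trivial, fun p hp => hV (lt_trans hp hn)⟩
    · rintro ⟨n, -, hV⟩
      exact ⟨_, by positivity, hV⟩
  exact hb.isCountablyGenerated

variable [mS : MeasurableSpace S] {μ : Measure S} {c_μ : ℝ}

/-- The uniformity is countably generated, hence given by a pseudometric, and finite Borel measures
on such spaces are outer regular. `A` is arbitrary, so no measurability of level sets is needed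
later. -/
lemma IsHomogeneousType.exists_isOpen_lt (hS : IsHomogeneousType d μ c_d c_μ) {B : Set S}
    (hB : μ B ≠ ∞) {A : Set S} {r : ℝ≥0∞} (hA : μ.restrict B A < r) :
    ∃ U, A ⊆ U ∧ @IsOpen S (qtopology d) U ∧ μ.restrict B U < r := by
  let := hS.isQuasiMetric.uniformSpace
  have := hS.isQuasiMetric.isCountablyGenerated_uniformity
  have : BorelSpace S :=
    ⟨by rw [hS.isQuasiMetric.toTopologicalSpace_uniformSpace]; exact hS.borel_eq⟩
  have : IsFiniteMeasure (μ.restrict B) := ⟨by simpa using hB.lt_top⟩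
  let := UniformSpace.pseudoMetricSpace S
  obtain ⟨U, hAU, hU, hlt⟩ := A.exists_isOpen_lt_of_lt (μ := μ.restrict B) r hA
  exact ⟨U, hAU, (hS.isQuasiMetric.isOpen_iff U).1 hU, hlt⟩

end OuterRegularity

/-! ### Geometry and measure of dyadic cubes -/

section Cubes

variable {S : Type*} {d : S → S → ℝ} {c_d c₀ C₀ δ : ℝ} {𝒟 : ℤ → Set (Set S)}

/-- A cube together with its generation. -/
abbrev Cube (𝒟 : ℤ → Set (Set S)) : Type _ := Σ k : ℤ, 𝒟 k

/-- The underlying set of a cube. -/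
def Cube.carrier (Q : Cube 𝒟) : Set S := Q.2.1

variable [MeasurableSpace S] {μ : Measure S} {c_μ : ℝ}

/-- The centre of a cube. -/
noncomputable def IsDyadicSystem.centre (h : IsDyadicSystem d c₀ C₀ δ 𝒟) (Q : Cube 𝒟) : S :=
  (h.center Q.1 Q.2.1 Q.2.2).choose

/-- The ball around the centre of a cube whose radius is `α` times that of the circumscribed
ball. -/
noncomputable def IsDyadicSystem.dilate (h : IsDyadicSystem d c₀ C₀ δ 𝒟) (α : ℝ) (Q : Cube 𝒟) :
    Set S :=
  qball d (h.centre Q) (α * (C₀ * δ ^ Q.1))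

variable (h : IsDyadicSystem d c₀ C₀ δ 𝒟)
include h

lemma IsDyadicSystem.qball_subset (Q : Cube 𝒟) :
    qball d (h.centre Q) (c₀ * δ ^ Q.1) ⊆ Q.carrier :=
  (h.center Q.1 Q.2.1 Q.2.2).choose_spec.1

lemma IsDyadicSystem.subset_qball (Q : Cube 𝒟) :
    Q.carrier ⊆ qball d (h.centre Q) (C₀ * δ ^ Q.1) :=
  (h.center Q.1 Q.2.1 Q.2.2).choose_spec.2

lemma IsDyadicSystem.measurableSet_carrier (Q : Cube 𝒟) : MeasurableSet Q.carrier :=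
  h.measurableSet _ _ Q.2.2

lemma IsDyadicSystem.exists_cube (k : ℤ) (s : S) : ∃ Q : Cube 𝒟, Q.1 = k ∧ s ∈ Q.carrier := by
  have hs : s ∈ ⋃₀ (𝒟 k) := by rw [h.cover]; trivial
  obtain ⟨Q, hQ, hs⟩ := hs
  exact ⟨⟨k, Q, hQ⟩, rfl, hs⟩

lemma IsDyadicSystem.eq_of_mem {P Q : Cube 𝒟} (hPQ : P.1 = Q.1) {s : S} (hP : s ∈ P.carrier)
    (hQ : s ∈ Q.carrier) : P = Q := by
  obtain ⟨k, P, hPk⟩ := P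
  obtain ⟨l, Q, hQl⟩ := Q
  obtain rfl : k = l := hPQ
  have : P = Q := by
    by_contra hne
    exact Set.disjoint_left.1 (h.disjoint k hPk hQl hne) hP hQ
  subst this
  rfl

lemma IsDyadicSystem.subset_of_mem {P Q : Cube 𝒟} (hPQ : Q.1 ≤ P.1) {s : S}
    (hP : s ∈ P.carrier) (hQ : s ∈ Q.carrier) : P.carrier ⊆ Q.carrier := by
  rcases h.nested P.1 Q.1 hPQ _ P.2.2 _ Q.2.2 with h' | h'
  · exact absurd (show s ∈ (P.2.1 ∩ Q.2.1 : Set S) from ⟨hP, hQ⟩) (by rw [h']; exact id)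
  · exact h'

lemma IsDyadicSystem.carrier_subset_dilate {α : ℝ} (hα : 1 ≤ α) (hC₀ : 0 < C₀) (hδ : 0 < δ)
    (Q : Cube 𝒟) : Q.carrier ⊆ h.dilate α Q :=
  (h.subset_qball Q).trans <| qball_mono _ <| by
    have := zpow_pos hδ Q.1
    exact le_mul_of_one_le_left (by positivity) hα

variable (hS : IsHomogeneousType d μ c_d c_μ)
include hS

lemma IsDyadicSystem.centre_mem (hc₀ : 0 < c₀) (hδ : 0 < δ) (Q : Cube 𝒟) :
    h.centre Q ∈ Q.carrier :=
  h.qball_subset Q (hS.isQuasiMetric.mem_qball_self _ (mul_pos hc₀ (zpow_pos hδ _)))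

lemma IsDyadicSystem.measure_carrier_pos (hc₀ : 0 < c₀) (hδ : 0 < δ) (Q : Cube 𝒟) :
    0 < μ Q.carrier :=
  (hS.ball_pos _ _ (mul_pos hc₀ (zpow_pos hδ _))).trans_le (measure_mono (h.qball_subset Q))

lemma IsDyadicSystem.measurableSet_dilate {α : ℝ} (hα : 0 < α) (hC₀ : 0 < C₀) (hδ : 0 < δ)
    (Q : Cube 𝒟) : MeasurableSet (h.dilate α Q) :=
  hS.measurableSet_ball _ _ (mul_pos hα (mul_pos hC₀ (zpow_pos hδ _)))

lemma IsDyadicSystem.measure_dilate_lt_top {α : ℝ} (hα : 0 < α) (hC₀ : 0 < C₀) (hδ : 0 < δ)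
    (Q : Cube 𝒟) : μ (h.dilate α Q) < ∞ :=
  hS.ball_lt_top _ _ (mul_pos hα (mul_pos hC₀ (zpow_pos hδ _)))

lemma IsDyadicSystem.measure_carrier_lt_top (hC₀ : 0 < C₀) (hδ : 0 < δ) (Q : Cube 𝒟) :
    μ Q.carrier < ∞ :=
  (measure_mono (h.carrier_subset_dilate le_rfl hC₀ hδ Q)).trans_lt
    (h.measure_dilate_lt_top hS one_pos hC₀ hδ Q)

lemma IsDyadicSystem.measure_dilate_le (hc₀ : 0 < c₀) (hδ : 0 < δ) (α : ℝ) (Q : Cube 𝒟) :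
    μ (h.dilate α Q) ≤ doublingConst c_μ (α * C₀ / c₀) * μ Q.carrier := by
  have h1 := hS.measure_qball_mul_le (h.centre Q) (α * C₀ / c₀)
    (mul_pos hc₀ (zpow_pos hδ Q.1))
  rw [show α * C₀ / c₀ * (c₀ * δ ^ Q.1) = α * (C₀ * δ ^ Q.1) by field_simp] at h1
  refine h1.trans ?_
  gcongr
  exact h.qball_subset Q

lemma IsDyadicSystem.countable_cube (hc₀ : 0 < c₀) (hδ : 0 < δ) : Countable (Cube 𝒟) := by
  have := hS.sigmaFinite
  have : ∀ k, Countable (𝒟 k) := fun k => by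
    refine countable_coe_iff.2 (countable_of_pairwiseDisjoint_measure_pos (μ := μ) id
      (fun Q hQ => h.measurableSet k Q hQ) (fun Q hQ => ?_) (h.disjoint k))
    exact h.measure_carrier_pos hS hc₀ hδ ⟨k, Q, hQ⟩
  infer_instance

lemma IsDyadicSystem.subset_dilate_of_parent (hC₀ : 0 < C₀) (hδ : 0 < δ) {α : ℝ}
    (hα : 2 * c_d / δ ≤ α) {P Q : Cube 𝒟} (hPQ : Q.1 + 1 = P.1) {s : S} (hsP : s ∈ P.carrier)
    (hsQ : s ∈ Q.carrier) (hz : h.centre P ∈ P.carrier) : Q.carrier ⊆ h.dilate α P := by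
  intro t ht
  have hq := hS.isQuasiMetric
  have h1 := h.subset_qball Q (h.subset_of_mem (by omega) hsP hsQ hz)
  have h2 := h.subset_qball Q ht
  have h1' : d (h.centre P) (h.centre Q) < C₀ * δ ^ Q.1 := by rw [hq.symm]; exact h1
  refine (hq.triangle_lt h1' h2).trans_le ?_
  rw [← hPQ, zpow_add_one₀ hδ.ne']
  have := zpow_pos hδ Q.1
  calc c_d * (C₀ * δ ^ Q.1 + C₀ * δ ^ Q.1) = 2 * c_d / δ * (C₀ * (δ ^ Q.1 * δ)) := by
        field_simp; ring
    _ ≤ α * (C₀ * (δ ^ Q.1 * δ)) := by gcongr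

omit h hS in
lemma exists_zpow_lt (hδ : 0 < δ) (hδ1 : δ < 1) (k : ℤ) {ε : ℝ} (hε : 0 < ε) :
    ∃ l, k < l ∧ δ ^ l < ε := by
  obtain ⟨n, hn⟩ := exists_pow_lt_of_lt_one (div_pos hε (zpow_pos hδ k)) hδ1
  refine ⟨k + (n + 1 : ℕ), by push_cast; omega, ?_⟩
  rw [zpow_add₀ hδ.ne', zpow_natCast, pow_succ]
  rw [lt_div_iff₀ (zpow_pos hδ k)] at hn
  have := zpow_pos hδ k
  have : 0 < δ ^ n * δ ^ k := by positivity
  nlinarith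

/-- This takes the place of a differentiation theorem: a point of an open set `U` lies in
arbitrarily small cubes in which `U` has density one. -/
lemma IsDyadicSystem.exists_cube_subset_of_isOpen (hC₀ : 0 < C₀) (hδ : 0 < δ) (hδ1 : δ < 1)
    {U : Set S} (hU : @IsOpen S (qtopology d) U) {s : S} (hs : s ∈ U) (k : ℤ) :
    ∃ P : Cube 𝒟, k < P.1 ∧ s ∈ P.carrier ∧ P.carrier ⊆ U := by
  have hq := hS.isQuasiMetric
  have hc := hq.pos
  obtain ⟨ε, hε, hεU⟩ := hU s hs
  obtain ⟨l, hkl, hl⟩ := exists_zpow_lt hδ hδ1 k (ε := ε / (2 * c_d * C₀)) (by positivity)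
  obtain ⟨P, rfl, hP⟩ := h.exists_cube l s
  refine ⟨P, hkl, hP, fun t ht => hεU ?_⟩
  have h1 : d s (h.centre P) < C₀ * δ ^ P.1 := by rw [hq.symm]; exact h.subset_qball P hP
  have h2 := hq.triangle_lt h1 (h.subset_qball P ht)
  rw [lt_div_iff₀ (by positivity)] at hl
  refine h2.trans_le ?_
  linarith

end Cubes

/-! ### Maximal cubes with a given property -/

section MaximalCubes

variable {S : Type*} {d : S → S → ℝ} {c_d c₀ C₀ δ : ℝ} {𝒟 : ℤ → Set (Set S)}

/-- The cubes with the property `p` that are maximal, i.e. of minimal generation. -/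
def maximalCubes (p : Cube 𝒟 → Prop) : Set (Cube 𝒟) :=
  {P | p P ∧ ∀ P' : Cube 𝒟, P'.1 < P.1 → P.carrier ⊆ P'.carrier → ¬ p P'}

variable [MeasurableSpace S] (h : IsDyadicSystem d c₀ C₀ δ 𝒟)
include h

lemma IsDyadicSystem.eq_of_mem_maximalCubes {p : Cube 𝒟 → Prop} {P P' : Cube 𝒟}
    (hP : P ∈ maximalCubes p) (hP' : P' ∈ maximalCubes p) {s : S} (hs : s ∈ P.carrier)
    (hs' : s ∈ P'.carrier) : P = P' := by
  rcases lt_trichotomy P.1 P'.1 with hlt | heq | hlt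
  · exact absurd hP.1 (hP'.2 P hlt (h.subset_of_mem hlt.le hs' hs))
  · exact h.eq_of_mem heq hs hs'
  · exact absurd hP'.1 (hP.2 P' hlt (h.subset_of_mem hlt.le hs hs'))

omit h [MeasurableSpace S] in
lemma exists_mem_maximalCubes {p : Cube 𝒟 → Prop} {s : S}
    (hex : ∃ P : Cube 𝒟, s ∈ P.carrier ∧ p P)
    (hbdd : ∃ b : ℤ, ∀ P : Cube 𝒟, s ∈ P.carrier → p P → b ≤ P.1) :
    ∃ P ∈ maximalCubes p, s ∈ P.carrier := by
  obtain ⟨b, hb⟩ := hbdd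
  obtain ⟨k, ⟨P, rfl, hs, hP⟩, hmin⟩ := Int.exists_least_of_bdd
    (P := fun k => ∃ P : Cube 𝒟, P.1 = k ∧ s ∈ P.carrier ∧ p P)
    ⟨b, by rintro _ ⟨P, rfl, h1, h2⟩; exact hb P h1 h2⟩
    (by obtain ⟨P, h1, h2⟩ := hex; exact ⟨P.1, P, rfl, h1, h2⟩)
  exact ⟨P, ⟨hP, fun P' hlt hsub hP' => not_le.2 hlt (hmin _ ⟨P', rfl, hsub hs, hP'⟩)⟩, hs⟩

end MaximalCubes

/-! ### Weak-type bounds and averages -/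

section WeakNorm

variable {S X : Type*} [MeasurableSpace S] [NormedAddCommGroup X] {μ : Measure S}

lemma weakNorm_le_weakOpNorm_mul {p : ℝ} {dom : Set (S → X)} {U : (S → X) → S → ℝ≥0∞}
    (hfin : weakOpNorm μ p dom U < ∞) {f : S → X} (hf : f ∈ dom)
    (hfp : eLpNorm f (ENNReal.ofReal p) μ ≠ ∞) :
    weakNorm μ p (U f) ≤ weakOpNorm μ p dom U * eLpNorm f (ENNReal.ofReal p) μ := by
  obtain ⟨A, hA, -⟩ := sInf_lt_iff.1 hfin
  by_cases h0 : eLpNorm f (ENNReal.ofReal p) μ = 0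
  · have := hA f hf
    rw [h0, mul_zero] at this ⊢
    exact this
  · rw [← ENNReal.div_le_iff h0 hfp]
    exact le_sInf fun B hB => (ENNReal.div_le_iff h0 hfp).2 (hB f hf)

lemma measure_lt_le_of_weakNorm_le {p : ℝ} (hp : 0 < p) {g : S → ℝ≥0∞} {a b : ℝ≥0∞}
    (ha : a ≠ ∞) (h : weakNorm μ p g ≤ a * b ^ (1 / p)) : μ {s | a < g s} ≤ b := by
  have hp' : 0 < 1 / p := one_div_pos.2 hp
  have ht : ∀ t : ℝ≥0, (t : ℝ≥0∞) * μ {s | (t : ℝ≥0∞) < g s} ^ (1 / p) ≤ a * b ^ (1 / p) :=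
    fun t => (le_iSup (fun t : ℝ≥0 => (t : ℝ≥0∞) * μ {s | (t : ℝ≥0∞) < g s} ^ (1 / p)) t).trans h
  -- The level `a = 0` gives no information when put into the weak norm, so it is approached through
  -- the levels `1 / (n + 1)`.
  rcases eq_or_ne a 0 with rfl | ha0
  · have hn : ∀ n : ℕ, μ {s | (((1 / (n + 1) : ℝ≥0)) : ℝ≥0∞) < g s} = 0 := by
      intro n
      have h1 := ht (1 / (n + 1))
      rw [zero_mul, nonpos_iff_eq_zero, mul_eq_zero] at h1
      rcases h1 with h1 | h1
      · rw [ENNReal.coe_eq_zero] at h1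
        exact absurd h1 (by positivity)
      · exact (ENNReal.rpow_eq_zero_iff_of_pos hp').1 h1
    have hsub : {s | 0 < g s} ⊆ ⋃ n : ℕ, {s | (((1 / (n + 1) : ℝ≥0)) : ℝ≥0∞) < g s} := by
      intro s hs
      obtain ⟨n, hn⟩ := ENNReal.exists_inv_nat_lt (ne_of_gt hs)
      refine mem_iUnion.2 ⟨n, lt_of_le_of_lt ?_ hn⟩
      rw [one_div, ENNReal.coe_inv (by positivity)]
      gcongr
      push_cast
      exact le_self_add
    exact (measure_mono_null hsub (measure_iUnion_null hn)).le.trans zero_le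
  · have h1 := ht a.toNNReal
    rw [ENNReal.coe_toNNReal ha, ENNReal.mul_le_mul_iff_right ha0 ha] at h1
    exact (ENNReal.rpow_le_rpow_iff hp').1 h1

lemma average_mul_rpow {q : ℝ} (hq : 0 < q) {W : Set S} (hW0 : μ W ≠ 0) (hWt : μ W ≠ ∞)
    (f : S → X) :
    average μ q W f * μ W ^ (1 / q) = eLpNorm f (ENNReal.ofReal q) (μ.restrict W) := by
  rw [average, ← ENNReal.mul_rpow_of_nonneg _ _ (by positivity), mul_right_comm,
    ENNReal.inv_mul_cancel hW0 hWt, one_mul,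
    eLpNorm_eq_lintegral_rpow_enorm_toReal (by simpa using hq) ENNReal.ofReal_ne_top,
    ENNReal.toReal_ofReal hq.le]

lemma average_ne_top {q : ℝ} (hq : 0 < q) {W : Set S} (hW0 : μ W ≠ 0) (hWt : μ W ≠ ∞)
    {f : S → X} (hf : MemLp f (ENNReal.ofReal q) μ) : average μ q W f ≠ ∞ := by
  have h := average_mul_rpow hq hW0 hWt f
  intro htop
  rw [htop, ENNReal.top_mul] at h
  · exact (hf.mono_measure Measure.restrict_le_self).2.ne h.symm
  · exact (ENNReal.rpow_pos hW0.bot_lt hWt).ne'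

lemma eLpNorm_le_average_mul {p q : ℝ} (hp : 0 < p) (hpq : p ≤ q) {W : Set S}
    (hWm : MeasurableSet W) (hW0 : μ W ≠ 0) (hWt : μ W ≠ ∞) {f : S → X}
    (hf : AEStronglyMeasurable f μ) (hsupp : Function.support f ⊆ W) :
    eLpNorm f (ENNReal.ofReal p) μ ≤ average μ q W f * μ W ^ (1 / p) := by
  have hq : 0 < q := hp.trans_le hpq
  have h1 : eLpNorm f (ENNReal.ofReal p) μ = eLpNorm f (ENNReal.ofReal p) (μ.restrict W) := by
    rw [← eLpNorm_indicator_eq_eLpNorm_restrict hWm, indicator_eq_self.2 hsupp]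
  have h2 := eLpNorm_le_eLpNorm_mul_rpow_measure_univ (μ := μ.restrict W)
    (ENNReal.ofReal_le_ofReal hpq) hf.restrict
  rw [h1]
  refine h2.trans_eq ?_
  rw [← average_mul_rpow hq hW0 hWt, ENNReal.toReal_ofReal hp.le, ENNReal.toReal_ofReal hq.le,
    Measure.restrict_apply_univ, mul_assoc, ← ENNReal.rpow_add _ _ hW0 hWt]
  congr 2
  ring

lemma memLp_of_support_subset {p q : ℝ} (hpq : p ≤ q) {W : Set S}
    (hWm : MeasurableSet W) (hWt : μ W ≠ ∞) {f : S → X}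
    (hf : MemLp f (ENNReal.ofReal q) μ) (hsupp : Function.support f ⊆ W) :
    MemLp f (ENNReal.ofReal p) μ := by
  have : IsFiniteMeasure (μ.restrict W) := ⟨by simpa using hWt.lt_top⟩
  rw [← indicator_eq_self.2 hsupp, memLp_indicator_iff_restrict hWm]
  exact (hf.mono_measure Measure.restrict_le_self).mono_exponent (ENNReal.ofReal_le_ofReal hpq)

lemma average_mono_fun {p : ℝ} (hp : 0 < p) {W : Set S} {f g : S → X}
    (h : ∀ s, ‖f s‖ₑ ≤ ‖g s‖ₑ) : average μ p W f ≤ average μ p W g := by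
  unfold average
  gcongr with s
  exact h s

/-- The natural constant is `D ^ (1 / p)`; it is enlarged to `D` to remove the dependence on `p`. -/
lemma average_le_mul_average {p : ℝ} (hp : 1 ≤ p) {D : ℝ≥0} (hD : 1 ≤ D) {W R : Set S}
    (hWR : W ⊆ R) (hRt : μ R ≠ ∞) (hW0 : μ W ≠ 0) (hμ : μ R ≤ D * μ W) (f : S → X) :
    average μ p W f ≤ D * average μ p R f := by
  have hp0 : 0 < p := one_pos.trans_le hp
  have hR0 : μ R ≠ 0 := fun h0 => hW0 (measure_mono_null hWR h0)
  have hWt : μ W ≠ ∞ := ((measure_mono hWR).trans_lt hRt.lt_top).ne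
  have hinv : (μ W)⁻¹ ≤ D * (μ R)⁻¹ := by
    rw [← div_eq_mul_inv, ENNReal.le_div_iff_mul_le (Or.inl hR0) (Or.inl hRt), mul_comm,
      ← div_eq_mul_inv, ENNReal.div_le_iff hW0 hWt]
    exact hμ
  have hD' : (D : ℝ≥0∞) ^ (1 / p) ≤ D := by
    conv_rhs => rw [← ENNReal.rpow_one (D : ℝ≥0∞)]
    exact ENNReal.rpow_le_rpow_of_exponent_le (by exact_mod_cast hD)
      (by rw [div_le_one hp0]; exact hp)
  calc average μ p W f ≤ (D * ((μ R)⁻¹ * ∫⁻ s in R, ‖f s‖ₑ ^ p ∂μ)) ^ (1 / p) := by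
        unfold average
        rw [← mul_assoc]
        gcongr
    _ = (D : ℝ≥0∞) ^ (1 / p) * average μ p R f := by
        rw [ENNReal.mul_rpow_of_nonneg _ _ (by positivity), average]
    _ ≤ _ := by gcongr

/-- The level sets of a function whose weak norm is controlled by the strong norm of a function
supported in `W`. -/
lemma mul_measure_lt_le {p q : ℝ} (hp : 1 ≤ p) (hpq : p ≤ q) {W : Set S}
    (hWm : MeasurableSet W) (hW0 : μ W ≠ 0) (hWt : μ W ≠ ∞) {f : S → X}
    (hf : MemLp f (ENNReal.ofReal q) μ) (hsupp : Function.support f ⊆ W)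
    {g : S → ℝ≥0∞} {A : ℝ≥0∞} (hA : A ≠ ∞)
    (hg : weakNorm μ p g ≤ A * eLpNorm f (ENNReal.ofReal p) μ) {κ : ℝ≥0} (hκ : 1 ≤ κ) :
    κ * μ {s | κ * (A * average μ q W f) < g s} ≤ μ W := by
  have hp0 : 0 < p := one_pos.trans_le hp
  have hκ0 : (κ : ℝ≥0∞) ≠ 0 := by
    have : κ ≠ 0 := (one_pos.trans_le hκ).ne'
    exact_mod_cast this
  have hκ' : (κ : ℝ≥0∞)⁻¹ ≤ (κ : ℝ≥0∞)⁻¹ ^ (1 / p) := by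
    conv_lhs => rw [← ENNReal.rpow_one (κ : ℝ≥0∞)⁻¹]
    refine ENNReal.rpow_le_rpow_of_exponent_ge ?_ (by rw [div_le_one hp0]; exact hp)
    exact ENNReal.inv_le_one.2 (by exact_mod_cast hκ)
  have hfa : average μ q W f ≠ ∞ := average_ne_top (hp0.trans_le hpq) hW0 hWt hf
  have h1 : μ {s | κ * (A * average μ q W f) < g s} ≤ (κ : ℝ≥0∞)⁻¹ * μ W := by
    refine measure_lt_le_of_weakNorm_le hp0
      (ENNReal.mul_ne_top ENNReal.coe_ne_top (ENNReal.mul_ne_top hA hfa)) (hg.trans ?_)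
    calc A * eLpNorm f (ENNReal.ofReal p) μ
        ≤ A * (average μ q W f * μ W ^ (1 / p)) := by
          gcongr
          exact eLpNorm_le_average_mul hp0 hpq hWm hW0 hWt hf.1 hsupp
      _ = κ * (A * average μ q W f) * ((κ : ℝ≥0∞)⁻¹ * μ W ^ (1 / p)) := by
          rw [show (κ : ℝ≥0∞) * (A * average μ q W f) * ((κ : ℝ≥0∞)⁻¹ * μ W ^ (1 / p)) =
            κ * (κ : ℝ≥0∞)⁻¹ * (A * (average μ q W f * μ W ^ (1 / p))) by ring,
            ENNReal.mul_inv_cancel hκ0 ENNReal.coe_ne_top, one_mul]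
      _ ≤ κ * (A * average μ q W f) * ((κ : ℝ≥0∞)⁻¹ * μ W) ^ (1 / p) := by
          rw [ENNReal.mul_rpow_of_nonneg _ _ (by positivity)]
          gcongr
  calc κ * μ {s | κ * (A * average μ q W f) < g s} ≤ κ * ((κ : ℝ≥0∞)⁻¹ * μ W) := by gcongr
    _ = μ W := by rw [← mul_assoc, ENNReal.mul_inv_cancel hκ0 ENNReal.coe_ne_top, one_mul]

end WeakNorm

/-! ### The operator on functions and lists of functions -/

section Operators

variable {S X Y 𝕜 : Type*} [MeasurableSpace S] [RCLike 𝕜]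
  [NormedAddCommGroup X] [NormedSpace 𝕜 X] [NormedAddCommGroup Y] [NormedSpace 𝕜 Y]
  {μ : Measure S} {p₁ : ℝ} (T : Lp X (ENNReal.ofReal p₁) μ →ₗ[𝕜] (S →ₘ[μ] Y))

lemma applyFun_add {f g : S → X} (hf : MemLp f (ENNReal.ofReal p₁) μ)
    (hg : MemLp g (ENNReal.ofReal p₁) μ) :
    applyFun T (f + g) =ᵐ[μ] applyFun T f + applyFun T g := by
  unfold applyFun
  rw [dif_pos hf, dif_pos hg, dif_pos (hf.add hg), hf.toLp_add hg, map_add]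
  exact AEEqFun.coeFn_add _ _

lemma applyFun_zero : applyFun T (0 : S → X) =ᵐ[μ] 0 := by
  unfold applyFun
  rw [dif_pos MemLp.zero, MemLp.toLp_zero, map_zero]
  exact AEEqFun.coeFn_zero

lemma IsSublinear.ae_enorm_le {T : Lp X (ENNReal.ofReal p₁) μ →ₗ[𝕜] (S →ₘ[μ] Y)}
    {d : S → S → ℝ} {p₀ r C_r : ℝ} (h : IsSublinear d p₀ r C_r T) (hr : 0 < r) (hC : 0 ≤ C_r)
    (l : List (S → X)) (hmem : ∀ f ∈ l, MemLp f (ENNReal.ofReal p₀) μ)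
    (hbdd : ∀ f ∈ l, BoundedlySupported d f)
    (hdisj : l.Pairwise fun f g => Disjoint (Function.support f) (Function.support g)) :
    ∀ᵐ s ∂μ, ‖applyFun T l.sum s‖ₑ ≤
      ENNReal.ofReal C_r * (l.map fun f => ‖applyFun T f s‖ₑ ^ r).sum ^ (1 / r) := by
  have h1 := h l.length l.get (fun k => hmem _ (l.get_mem k)) (fun k => hbdd _ (l.get_mem k))
    (fun k m hkm => by
      rcases lt_or_gt_of_ne hkm with hlt | hlt
      · exact List.pairwise_iff_get.1 hdisj k m hlt
      · exact (List.pairwise_iff_get.1 hdisj m k hlt).symm)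
  filter_upwards [h1] with s hs
  have e1 : ∑ k, l.get k = l.sum := by
    rw [← List.sum_ofFn, List.ofFn_get]
  have e2 : (l.map fun f => ‖applyFun T f s‖ₑ ^ r).sum = ∑ k, ‖applyFun T (l.get k) s‖ₑ ^ r := by
    conv_lhs => rw [← List.ofFn_get (l := l), List.map_ofFn, List.sum_ofFn]
    rfl
  rw [e1] at hs
  rw [e2]
  have hnn : 0 ≤ ∑ k, ‖applyFun T (l.get k) s‖ ^ r :=
    Finset.sum_nonneg fun k _ => Real.rpow_nonneg (norm_nonneg _) _
  calc ‖applyFun T l.sum s‖ₑ = ENNReal.ofReal ‖applyFun T l.sum s‖ := (ofReal_norm _).symm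
    _ ≤ ENNReal.ofReal (C_r * (∑ k, ‖applyFun T (l.get k) s‖ ^ r) ^ (1 / r)) :=
        ENNReal.ofReal_le_ofReal hs
    _ = _ := by
        rw [ENNReal.ofReal_mul hC, ← ENNReal.ofReal_rpow_of_nonneg hnn (by positivity),
          ENNReal.ofReal_sum_of_nonneg fun k _ => Real.rpow_nonneg (norm_nonneg _) _]
        simp_rw [← ENNReal.ofReal_rpow_of_nonneg (norm_nonneg _) hr.le, ofReal_norm]

end Operators

/-! ### The stopping time argument in one cube -/

section StoppingCubes

variable {S : Type*} {d : S → S → ℝ} {c_d c_μ c₀ C₀ δ : ℝ} {𝒟 : ℤ → Set (Set S)}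
  [MeasurableSpace S] {μ : Measure S}

/-- The maximal proper subcubes of `Q` in which an open set `U` has a large density, if `U` has
a small density in `Q`. -/
lemma IsDyadicSystem.exists_stopping_cubes (h : IsDyadicSystem d c₀ C₀ δ 𝒟)
    (hS : IsHomogeneousType d μ c_d c_μ) (hc₀ : 0 < c₀) (hC₀ : 0 < C₀) (hδ : 0 < δ) (hδ1 : δ < 1)
    {α : ℝ} (hα : 2 * c_d / δ ≤ α) {D : ℝ≥0} (hD1 : 1 ≤ D)
    (hD : ∀ Q : Cube 𝒟, μ (h.dilate α Q) ≤ D * μ Q.carrier) (Q : Cube 𝒟) {U : Set S}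
    (hU : @IsOpen S (qtopology d) U) (hUm : MeasurableSet U)
    (hUQ : 8 * D * μ (Q.carrier ∩ U) ≤ μ Q.carrier) :
    ∃ 𝒞 : Set (Cube 𝒟),
      (∀ P ∈ 𝒞, ∀ P' ∈ 𝒞, ∀ s, s ∈ P.carrier → s ∈ P'.carrier → P = P') ∧
      (∀ P ∈ 𝒞, P.carrier ⊆ Q.carrier) ∧
      2 * μ (⋃ P ∈ 𝒞, P.carrier) ≤ μ Q.carrier ∧
      (∀ s ∈ Q.carrier, (∀ P ∈ 𝒞, s ∉ P.carrier) → s ∉ U) ∧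
      ∀ P ∈ 𝒞, 4 * μ (P.carrier ∩ U) ≤ μ P.carrier := by
  have := h.countable_cube hS hc₀ hδ
  have hD0 : (D : ℝ≥0∞) ≠ 0 := by
    have : D ≠ 0 := (one_pos.trans_le hD1).ne'
    exact_mod_cast this
  have hDt : (D : ℝ≥0∞) ≠ ∞ := ENNReal.coe_ne_top
  -- With the threshold `4 * D`, the selected cubes have total measure at most `4 * D * μ (Q ∩ U)`,
  -- at most half of `μ Q`. The parent of a selected cube has density at most `1 / (4 * D)`, hence
  -- the cube itself at most `1 / 4`.
  let p : Cube 𝒟 → Prop := fun P => Q.1 < P.1 ∧ P.carrier ⊆ Q.carrier ∧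
    μ P.carrier < 4 * D * μ (P.carrier ∩ U)
  have hdisj : ∀ P ∈ maximalCubes p, ∀ P' ∈ maximalCubes p, ∀ s, s ∈ P.carrier →
      s ∈ P'.carrier → P = P' := fun P hP P' hP' s hs hs' =>
    h.eq_of_mem_maximalCubes hP hP' hs hs'
  have hpair : (maximalCubes p).PairwiseDisjoint Cube.carrier := fun P hP P' hP' hne =>
    Set.disjoint_left.2 fun s hs hs' => hne (hdisj P hP P' hP' s hs hs')
  have hpair' : (maximalCubes p).PairwiseDisjoint fun P => P.carrier ∩ U :=
    hpair.mono fun P => inter_subset_left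
  have hDU : 4 * D * μ (Q.carrier ∩ U) ≤ μ Q.carrier :=
    le_trans (by gcongr; norm_num) hUQ
  refine ⟨maximalCubes p, hdisj, fun P hP => hP.1.2.1, ?_, ?_, ?_⟩
  · calc 2 * μ (⋃ P ∈ maximalCubes p, P.carrier)
        = 2 * ∑' P : maximalCubes p, μ P.1.carrier := by
          rw [measure_biUnion (to_countable _) hpair fun P _ => h.measurableSet_carrier P]
      _ ≤ 2 * ∑' P : maximalCubes p, 4 * D * μ (P.1.carrier ∩ U) := by
          gcongr with P
          exact P.2.1.2.2.le
      _ = 8 * D * μ (⋃ P ∈ maximalCubes p, P.carrier ∩ U) := by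
          rw [measure_biUnion (to_countable _) hpair'
            fun P _ => (h.measurableSet_carrier P).inter hUm, ENNReal.tsum_mul_left]
          ring
      _ ≤ 8 * D * μ (Q.carrier ∩ U) := by
          gcongr
          exact iUnion₂_subset fun P hP => inter_subset_inter_left U hP.1.2.1
      _ ≤ μ Q.carrier := hUQ
  · intro s hsQ hs hsU
    obtain ⟨P, hQP, hsP, hPU⟩ := h.exists_cube_subset_of_isOpen hS hC₀ hδ hδ1 hU hsU Q.1
    obtain ⟨P', hP', hsP'⟩ := exists_mem_maximalCubes (p := p) (s := s)
      ⟨P, hsP, hQP, h.subset_of_mem hQP.le hsP hsQ, by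
        rw [inter_eq_left.2 hPU]
        have hpos := h.measure_carrier_pos hS hc₀ hδ P
        have hfin := h.measure_carrier_lt_top hS hC₀ hδ P
        calc μ P.carrier = 1 * μ P.carrier := (one_mul _).symm
          _ < 4 * D * μ P.carrier := by
            rw [ENNReal.mul_lt_mul_iff_left hpos.ne' hfin.ne]
            calc (1 : ℝ≥0∞) < 4 * 1 := by norm_num
              _ ≤ 4 * D := by gcongr; exact_mod_cast hD1⟩
      ⟨Q.1, fun P _ hP => hP.1.le⟩
    exact hs P' hP' hsP'
  · intro P hP
    have hz := h.centre_mem hS hc₀ hδ P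
    obtain ⟨P', hP'1, hzP'⟩ := h.exists_cube (P.1 - 1) (h.centre P)
    have hPP' : P.carrier ⊆ P'.carrier := h.subset_of_mem (by omega) hz hzP'
    have hnp : ¬ p P' := hP.2 P' (by omega) hPP'
    have hzQ := hP.1.2.1 hz
    have hQP := hP.1.1
    have hle : 4 * D * μ (P'.carrier ∩ U) ≤ μ P'.carrier := by
      -- The parent may be `Q`, which is no candidate; there the density is small by assumption.
      rcases (show Q.1 ≤ P'.1 by omega).eq_or_lt with heq | hlt
      · rwa [← h.eq_of_mem heq hzQ hzP']
      · by_contra! hcon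
        exact hnp ⟨hlt, h.subset_of_mem hlt.le hzP' hzQ, hcon⟩
    have hle' : D * (4 * μ (P.carrier ∩ U)) ≤ D * μ P.carrier :=
      calc D * (4 * μ (P.carrier ∩ U)) = 4 * D * μ (P.carrier ∩ U) := by ring
        _ ≤ 4 * D * μ (P'.carrier ∩ U) := by gcongr
        _ ≤ μ P'.carrier := hle
        _ ≤ μ (h.dilate α P) :=
          measure_mono (h.subset_dilate_of_parent hS hC₀ hδ hα (by omega) hz hzP' hz)
        _ ≤ D * μ P.carrier := hD P
    exact (ENNReal.mul_le_mul_iff_right hD0 hDt).1 hle'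

/-- Produces the good point: a set too large to be covered by the bad set `B` meets every almost
sure event outside `B`. Only outer measures enter. -/
lemma exists_mem_of_ae_restrict {A B C : Set S} {q : S → Prop} (hA : A ⊆ C)
    (hAB : ¬ μ A ≤ μ B) (hCm : MeasurableSet C) (hq : ∀ᵐ s ∂μ.restrict C, q s) :
    ∃ s ∈ A, s ∉ B ∧ q s := by
  rw [ae_restrict_iff' hCm] at hq
  by_contra! hcon
  refine hAB ?_
  have hsub : A ⊆ B ∪ {s | ¬ (s ∈ C → q s)} := by
    intro s hs
    by_cases hB : s ∈ B
    · exact Or.inl hB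
    · exact Or.inr fun hqs => hcon s hs hB (hqs (hA hs))
  calc μ A ≤ μ B + μ {s | ¬ (s ∈ C → q s)} := (measure_mono hsub).trans (measure_union_le _ _)
    _ = μ B := by rw [ae_iff.1 hq, add_zero]

variable {X Y 𝕜 : Type*} [RCLike 𝕜]
  [NormedAddCommGroup X] [NormedSpace 𝕜 X] [NormedAddCommGroup Y] [NormedSpace 𝕜 Y]
  {p₁ p₂ : ℝ} {T : Lp X (ENNReal.ofReal p₁) μ →ₗ[𝕜] (S →ₘ[μ] Y)}

/-- One step of the stopping time argument. -/
lemma IsDyadicSystem.exists_stopping_family (h : IsDyadicSystem d c₀ C₀ δ 𝒟)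
    (hS : IsHomogeneousType d μ c_d c_μ) (hc₀ : 0 < c₀) (hC₀ : 0 < C₀) (hδ : 0 < δ) (hδ1 : δ < 1)
    {α : ℝ} (hα1 : 1 ≤ α) (hα : 2 * c_d / δ ≤ α) {D : ℝ≥0} (hD1 : 1 ≤ D)
    (hD : ∀ Q : Cube 𝒟, μ (h.dilate α Q) ≤ D * μ Q.carrier)
    (hp₁ : 1 ≤ p₁) (hp₂ : 1 ≤ p₂)
    (hA : opNorm T < ∞) (hM : sharpMaximalNorm d α p₂ T < ∞) (Q : Cube 𝒟) {g : S → X}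
    (hg : MemLp g (ENNReal.ofReal (max p₁ p₂)) μ) (hsupp : Function.support g ⊆ h.dilate α Q) :
    ∃ 𝒞 : Set (Cube 𝒟),
      (∀ P ∈ 𝒞, ∀ P' ∈ 𝒞, ∀ s, s ∈ P.carrier → s ∈ P'.carrier → P = P') ∧
      (∀ P ∈ 𝒞, P.carrier ⊆ Q.carrier) ∧
      2 * μ (⋃ P ∈ 𝒞, P.carrier) ≤ μ Q.carrier ∧
      (∀ s ∈ Q.carrier, (∀ P ∈ 𝒞, s ∉ P.carrier) →
        ‖applyFun T g s‖ₑ ≤ (24 * D ^ 2 : ℝ≥0) *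
          (opNorm T * average μ (max p₁ p₂) (h.dilate α Q) g)) ∧
      ∀ P ∈ 𝒞, ∀ᵐ s ∂μ, s ∈ P.carrier →
        ‖applyFun T ((h.dilate α P)ᶜ.indicator g) s‖ₑ ≤
          (24 * D ^ 2 : ℝ≥0) * (opNorm T + sharpMaximalNorm d α p₂ T) *
            (average μ (max p₁ p₂) (h.dilate α Q) g +
              average μ (max p₁ p₂) (h.dilate α P) g) := by
  have := hS.sigmaFinite
  have hα0 : 0 < α := one_pos.trans_le hα1
  have hD0 : (D : ℝ≥0∞) ≠ 0 := by
    have : D ≠ 0 := (one_pos.trans_le hD1).ne'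
    exact_mod_cast this
  have hDt : (D : ℝ≥0∞) ≠ ∞ := ENNReal.coe_ne_top
  -- One factor `D` passes from `W P` to `P`, the other meets the density `1 / (8 * D)` required of
  -- `U`. Each level set then has at most the fraction `1 / (24 * D)` of the cube, and two of them
  -- stay strictly below `1 / (8 * D)`, with room for an open superset.
  set κ : ℝ≥0 := 24 * D ^ 2 with hκ
  have hκ1 : 1 ≤ κ := by
    rw [hκ]
    calc (1 : ℝ≥0) ≤ 24 * 1 ^ 2 := by norm_num
      _ ≤ 24 * D ^ 2 := by gcongr
  set p₀ := max p₁ p₂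
  set A := opNorm T
  set M := sharpMaximalNorm d α p₂ T
  have hWm : ∀ P : Cube 𝒟, MeasurableSet (h.dilate α P) :=
    fun P => h.measurableSet_dilate hS hα0 hC₀ hδ P
  have hWt : ∀ P : Cube 𝒟, μ (h.dilate α P) ≠ ∞ :=
    fun P => (h.measure_dilate_lt_top hS hα0 hC₀ hδ P).ne
  have hQpos : ∀ P : Cube 𝒟, μ P.carrier ≠ 0 :=
    fun P => (h.measure_carrier_pos hS hc₀ hδ P).ne'
  have hQt : ∀ P : Cube 𝒟, μ P.carrier ≠ ∞ :=
    fun P => (h.measure_carrier_lt_top hS hC₀ hδ P).ne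
  have hQW : ∀ P : Cube 𝒟, P.carrier ⊆ h.dilate α P :=
    fun P => h.carrier_subset_dilate hα1 hC₀ hδ P
  have hW0 : ∀ P : Cube 𝒟, μ (h.dilate α P) ≠ 0 :=
    fun P h0 => hQpos P (measure_mono_null (hQW P) h0)
  have hlevel : ∀ (P : Cube 𝒟) (E : Set S), κ * μ E ≤ μ (h.dilate α P) →
      24 * D * μ E ≤ μ P.carrier := by
    intro P E hE
    refine (ENNReal.mul_le_mul_iff_right hD0 hDt).1 ?_
    calc (D : ℝ≥0∞) * (24 * D * μ E) = κ * μ E := by rw [hκ]; push_cast; ring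
      _ ≤ _ := hE.trans (hD P)
  have hmem₁ : ∀ (P : Cube 𝒟) (f : S → X), MemLp f (ENNReal.ofReal p₀) μ →
      Function.support f ⊆ h.dilate α P → MemLp f (ENNReal.ofReal p₁) μ := fun P f hf hs =>
    memLp_of_support_subset (le_max_left _ _) (hWm P) (hWt P) hf hs
  have hΩT : ∀ (P : Cube 𝒟) (f : S → X), MemLp f (ENNReal.ofReal p₀) μ →
      Function.support f ⊆ h.dilate α P →
      24 * D * μ {s | κ * (A * average μ p₀ (h.dilate α P) f) < ‖applyFun T f s‖ₑ} ≤
        μ P.carrier := by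
    intro P f hf hs
    have hf1 := hmem₁ P f hf hs
    exact hlevel P _ (mul_measure_lt_le hp₁ (le_max_left _ _) (hWm P) (hW0 P) (hWt P) hf hs hA.ne
      (weakNorm_le_weakOpNorm_mul hA hf1 hf1.2.ne) hκ1)
  have hΩM : 24 * D * μ {s | κ * (M * average μ p₀ (h.dilate α Q) g) < sharpMaximal d α T g s} ≤
      μ Q.carrier := by
    have hg1 := hmem₁ Q g hg hsupp
    have hg2 : MemLp g (ENNReal.ofReal p₂) μ :=
      memLp_of_support_subset (le_max_right _ _) (hWm Q) (hWt Q) hg hsupp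
    exact hlevel Q _ (mul_measure_lt_le hp₂ (le_max_right _ _) (hWm Q) (hW0 Q) (hWt Q) hg hsupp
      hM.ne (weakNorm_le_weakOpNorm_mul hM ⟨hg1, hg2⟩ hg2.2.ne) hκ1)
  have hΩTQ := hΩT Q g hg hsupp
  set a : Cube 𝒟 → ℝ≥0∞ := fun P => average μ p₀ (h.dilate α P) g with ha
  set Ω₁ := {s | κ * (A * a Q) < ‖applyFun T g s‖ₑ} with hΩ₁
  set Ω₂ := {s | κ * (M * a Q) < sharpMaximal d α T g s} with hΩ₂
  have hΩ : μ.restrict Q.carrier (Ω₁ ∪ Ω₂) < μ Q.carrier / (8 * D) := by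
    refine ((Measure.restrict_apply_le _ _).trans (measure_union_le _ _)).trans_lt ?_
    rw [ENNReal.lt_div_iff_mul_lt (Or.inl (by simp [hD0])) (Or.inl (by finiteness))]
    by_contra! hcon
    have : 3 * μ Q.carrier ≤ 2 * μ Q.carrier :=
      calc 3 * μ Q.carrier ≤ 3 * ((μ Ω₁ + μ Ω₂) * (8 * D)) := by gcongr
        _ = 24 * D * μ Ω₁ + 24 * D * μ Ω₂ := by ring
        _ ≤ μ Q.carrier + μ Q.carrier := add_le_add hΩTQ hΩM
        _ = 2 * μ Q.carrier := (two_mul _).symm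
    rw [ENNReal.mul_le_mul_iff_left (hQpos Q) (hQt Q)] at this
    exact absurd this (by norm_num)
  obtain ⟨U, hΩU, hU, hUlt⟩ := hS.exists_isOpen_lt (hQt Q) hΩ
  have hUm : MeasurableSet U := by
    have hb := hS.borel_eq
    rw [hb]
    exact MeasurableSpace.measurableSet_generateFrom hU
  rw [Measure.restrict_apply hUm, inter_comm] at hUlt
  have h8 : 8 * (D : ℝ≥0∞) * μ (Q.carrier ∩ U) ≤ μ Q.carrier := by
    rw [mul_comm]
    refine (ENNReal.le_div_iff_mul_le (Or.inr (hQpos Q)) (Or.inr (hQt Q))).1 hUlt.le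
  obtain ⟨𝒞, h1, h2, h3, h4, h5⟩ :=
    h.exists_stopping_cubes hS hc₀ hC₀ hδ hδ1 hα hD1 hD Q hU hUm h8
  refine ⟨𝒞, h1, h2, h3, fun s hs hsP => ?_, fun P hP => ?_⟩
  · by_contra! hcon
    exact h4 s hs hsP (hΩU (Or.inl hcon))
  set g' := (h.dilate α P).indicator g with hg'
  set g'' := (h.dilate α P)ᶜ.indicator g with hg''
  have hg'mem : MemLp g' (ENNReal.ofReal p₀) μ := hg.indicator (hWm P)
  have hg''mem : MemLp g'' (ENNReal.ofReal p₀) μ := hg.indicator (hWm P).compl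
  have hsum : g' + g'' = g := indicator_self_add_compl _ _
  have hadd := applyFun_add T (hmem₁ P g' hg'mem support_indicator_subset)
    (hmem₁ Q g'' hg''mem ((support_indicator (f := g)).trans_subset
      (inter_subset_right.trans hsupp)))
  rw [hsum] at hadd
  have ha' : average μ p₀ (h.dilate α P) g' ≤ a P :=
    average_mono_fun (one_pos.trans_le (hp₁.trans (le_max_left _ _)))
      fun s => enorm_indicator_le_enorm_self _ _
  have hΩ₃ := hΩT P g' hg'mem support_indicator_subset
  set Ω₃ := {s | κ * (A * average μ p₀ (h.dilate α P) g') < ‖applyFun T g' s‖ₑ}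
  have hPt := hQt P
  have hP0 := hQpos P
  -- `P ∩ U` and `Ω₃` each take up at most a quarter of `P`.
  have hbad : ¬ μ P.carrier ≤ μ ((P.carrier ∩ U) ∪ Ω₃) := by
    intro hcon
    have : 4 * μ P.carrier ≤ 2 * μ P.carrier :=
      calc 4 * μ P.carrier ≤ 4 * (μ (P.carrier ∩ U) + μ Ω₃) := by
            gcongr; exact hcon.trans (measure_union_le _ _)
        _ = 4 * μ (P.carrier ∩ U) + 4 * 1 * μ Ω₃ := by ring
        _ ≤ μ P.carrier + 24 * D * μ Ω₃ := by
            gcongr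
            · exact h5 P hP
            · norm_num
            · exact_mod_cast hD1
        _ ≤ μ P.carrier + μ P.carrier := by gcongr
        _ = 2 * μ P.carrier := (two_mul _).symm
    rw [ENNReal.mul_le_mul_iff_left hP0 hPt] at this
    exact absurd this (by norm_num)
  set B := qball d (h.centre P) (C₀ * δ ^ P.1) with hB
  have hρ : 0 < C₀ * δ ^ P.1 := mul_pos hC₀ (zpow_pos hδ _)
  have hBm : MeasurableSet B := hS.measurableSet_ball _ _ hρ
  have hPB : P.carrier ⊆ B := h.subset_qball P
  -- By Fubini the essential supremum over pairs bounds, for almost every fixed `s'`, the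
  -- oscillation against almost every `s''`; the good point has to be such an `s'`.
  have hosc : ∀ᵐ s' ∂μ.restrict B, (∀ᵐ s'' ∂μ.restrict B,
      ‖applyFun T g'' s' - applyFun T g'' s''‖ₑ ≤
        essSup (fun q : S × S => ‖applyFun T g'' q.1 - applyFun T g'' q.2‖ₑ)
          ((μ.restrict B).prod (μ.restrict B))) ∧
      applyFun T g s' = applyFun T g' s' + applyFun T g'' s' := by
    refine (Measure.ae_ae_of_ae_prod (ENNReal.ae_le_essSup _)).and ?_
    exact ae_restrict_of_ae hadd
  obtain ⟨s', hs'P, hs'bad, hs'osc, hs'add⟩ :=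
    exists_mem_of_ae_restrict hPB hbad hBm hosc
  simp only [mem_union, mem_inter_iff, hs'P, true_and, not_or] at hs'bad
  have hT1 : ‖applyFun T g s'‖ₑ ≤ κ * (A * a Q) := by
    by_contra! hcon
    exact hs'bad.1 (hΩU (Or.inl hcon))
  have hT2 : sharpMaximal d α T g s' ≤ κ * (M * a Q) := by
    by_contra! hcon
    exact hs'bad.1 (hΩU (Or.inr hcon))
  have hT3 : ‖applyFun T g' s'‖ₑ ≤ κ * (A * a P) := by
    refine le_trans (not_lt.1 hs'bad.2) ?_
    gcongr
  have hess : essSup (fun q : S × S => ‖applyFun T g'' q.1 - applyFun T g'' q.2‖ₑ)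
      ((μ.restrict B).prod (μ.restrict B)) ≤ κ * (M * a Q) := by
    refine le_trans ?_ hT2
    exact le_iSup_of_le (h.centre P) <| le_iSup_of_le (C₀ * δ ^ P.1) <| le_iSup_of_le hρ <|
      le_iSup_of_le (hPB hs'P) le_rfl
  rw [ae_restrict_iff' hBm] at hs'osc
  filter_upwards [hs'osc] with s hs hsP
  -- The first two terms are evaluated at the good point `s'`; the last one is an oscillation over
  -- `B`, where `g''` vanishes on the `α`-dilate of `B`.
  have e1 : applyFun T g'' s =
      applyFun T g s' - applyFun T g' s' - (applyFun T g'' s' - applyFun T g'' s) := by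
    rw [hs'add]; abel
  calc ‖applyFun T g'' s‖ₑ
      ≤ ‖applyFun T g s'‖ₑ + ‖applyFun T g' s'‖ₑ + ‖applyFun T g'' s' - applyFun T g'' s‖ₑ := by
        refine (congrArg _ e1).trans_le (enorm_sub_le.trans ?_)
        gcongr
        exact enorm_sub_le
    _ ≤ κ * (A * a Q) + κ * (A * a P) + κ * (M * a Q) := by
        gcongr
        exact (hs (hPB hsP)).trans hess
    _ ≤ κ * (A * a Q) + κ * (A * a P) + κ * (M * a Q) + κ * (M * a P) := le_self_add
    _ = κ * (A + M) * (a Q + a P) := by ring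

end StoppingCubes

/-! ### Chains of stopping cubes -/

section Chains

variable {S ι : Type*} {carrier : ι → Set S} {Ch : List ι → Set ι}

/-- The set of the most recent member of a list. -/
def headCarrier (carrier : ι → Set S) : List ι → Set S
  | [] => univ
  | P :: _ => carrier P

/-- A list each of whose members is chosen by `Ch` on the basis of the members after it. -/
def StoppingChain (Ch : List ι → Set ι) : List ι → Prop
  | [] => True
  | P :: l => P ∈ Ch l ∧ StoppingChain Ch l

/-- `Ch` chooses disjoint subsets of the most recently chosen set. -/
structure IsStoppingRule (carrier : ι → Set S) (Ch : List ι → Set ι) : Prop where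
  eq_of_mem : ∀ l, ∀ P ∈ Ch l, ∀ P' ∈ Ch l, ∀ s, s ∈ carrier P → s ∈ carrier P' → P = P'
  subset : ∀ l, ∀ P ∈ Ch l, carrier P ⊆ headCarrier carrier l
  top : ∀ s, ∃ P ∈ Ch [], s ∈ carrier P

/-- The part of the head of a list that is not covered by the sets that `Ch` chooses next. -/
def remainder (carrier : ι → Set S) (Ch : List ι → Set ι) (l : List ι) : Set S :=
  headCarrier carrier l \ ⋃ P ∈ Ch l, carrier P

namespace IsStoppingRule

variable (h : IsStoppingRule carrier Ch)
include h

lemma mem_of_mem_head {l : List ι} (hl : StoppingChain Ch l) {s : S}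
    (hs : s ∈ headCarrier carrier l) : ∀ P ∈ l, s ∈ carrier P := by
  induction l with
  | nil => simp
  | cons P l ih =>
    intro Q hQ
    rcases List.mem_cons.1 hQ with rfl | hQ
    · exact hs
    · exact ih hl.2 (h.subset l P hl.1 hs) Q hQ

/-- Chains through a common point can differ only in length: once the tails agree, both heads are
chosen from the same disjoint family. -/
lemma eq_of_length_eq {l l' : List ι} (hl : StoppingChain Ch l) (hl' : StoppingChain Ch l')
    {s : S} (hs : ∀ P ∈ l, s ∈ carrier P) (hs' : ∀ P ∈ l', s ∈ carrier P)
    (hlen : l.length = l'.length) : l = l' := by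
  induction l generalizing l' with
  | nil => exact (List.length_eq_zero_iff.1 hlen.symm).symm
  | cons P l ih =>
    cases l' with
    | nil => simp at hlen
    | cons P' l' =>
      obtain rfl := ih hl.2 hl'.2 (fun Q hQ => hs Q (List.mem_cons_of_mem _ hQ))
        (fun Q hQ => hs' Q (List.mem_cons_of_mem _ hQ)) (by simpa using hlen)
      rw [h.eq_of_mem l P hl.1 P' hl'.1 s (hs P List.mem_cons_self) (hs' P' List.mem_cons_self)]

/-- A longer chain through `s` would extend `l` by a set containing `s`, but `s` lies in no set
chosen after `l`. -/
lemma length_le {l l' : List ι} (hl : StoppingChain Ch l) (hl' : StoppingChain Ch l')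
    {s : S} (hs : s ∈ remainder carrier Ch l) (hs' : ∀ P ∈ l', s ∈ carrier P) :
    l'.length ≤ l.length := by
  induction l' with
  | nil => simp
  | cons P l' ih =>
    have hs'' : ∀ Q ∈ l', s ∈ carrier Q := fun Q hQ => hs' Q (List.mem_cons_of_mem _ hQ)
    rcases (ih hl'.2 hs'').lt_or_eq with hlt | heq
    · simpa using hlt
    · obtain rfl := h.eq_of_length_eq hl'.2 hl hs'' (h.mem_of_mem_head hl hs.1) heq
      exact absurd (mem_iUnion₂.2 ⟨P, hl'.1, hs' P List.mem_cons_self⟩) hs.2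

lemma disjoint_remainder {l l' : List ι} (hl : StoppingChain Ch l) (hl' : StoppingChain Ch l')
    (hne : l ≠ l') : Disjoint (remainder carrier Ch l) (remainder carrier Ch l') := by
  refine Set.disjoint_left.2 fun s hs hs' => hne ?_
  have h1 := h.mem_of_mem_head hl hs.1
  have h2 := h.mem_of_mem_head hl' hs'.1
  exact h.eq_of_length_eq hl hl' h1 h2
    (le_antisymm (h.length_le hl' hl hs' h1) (h.length_le hl hl' hs h2))

variable [MeasurableSpace S] {μ : Measure S} [Countable ι]

/-- The sets chosen next cover at most half of the head, so the rest is at least half. -/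
lemma measure_head_le (hm : ∀ P, MeasurableSet (carrier P))
    (hfin : ∀ P, μ (carrier P) ≠ ∞)
    (hhalf : ∀ l, l ≠ [] → 2 * μ (⋃ P ∈ Ch l, carrier P) ≤ μ (headCarrier carrier l))
    {l : List ι} (hl0 : l ≠ []) :
    μ (headCarrier carrier l) ≤ 2 * μ (remainder carrier Ch l) := by
  have hm' : MeasurableSet (⋃ P ∈ Ch l, carrier P) :=
    MeasurableSet.biUnion (to_countable _) fun P _ => hm P
  have hsub : (⋃ P ∈ Ch l, carrier P) ⊆ headCarrier carrier l :=
    iUnion₂_subset fun P hP => h.subset l P hP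
  have hHt : μ (headCarrier carrier l) ≠ ∞ := by
    cases l with
    | nil => exact absurd rfl hl0
    | cons P l => exact hfin P
  have h1 : μ (remainder carrier Ch l) + μ (⋃ P ∈ Ch l, carrier P) =
      μ (headCarrier carrier l) := by
    rw [remainder, measure_sdiff hsub hm'.nullMeasurableSet
      ((measure_mono hsub).trans_lt hHt.lt_top).ne]
    exact tsub_add_cancel_of_le (measure_mono hsub)
  have h2 := hhalf l hl0
  rw [← h1] at h2 hHt ⊢
  have h3 : μ (⋃ P ∈ Ch l, carrier P) ≠ ∞ := (ENNReal.add_ne_top.1 hHt).2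
  rw [two_mul] at h2 ⊢
  exact add_le_add le_rfl ((ENNReal.add_le_add_iff_right h3).1 h2)

/-- Almost every point is left over by some chain. -/
lemma ae_mem_remainder (hm : ∀ P, MeasurableSet (carrier P)) (hfin : ∀ P, μ (carrier P) ≠ ∞)
    (hhalf : ∀ l, l ≠ [] → 2 * μ (⋃ P ∈ Ch l, carrier P) ≤ μ (headCarrier carrier l)) :
    ∀ᵐ s ∂μ, ∃ l, l ≠ [] ∧ StoppingChain Ch l ∧ s ∈ remainder carrier Ch l := by
  -- `layer c n` consists of the chains that start with `c` and make `n` further choices. The union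
  -- `V c n` of their heads loses half of its measure at each step, so the points of `c` that are
  -- never left over form a null set.
  let layer : ι → ℕ → Set (List ι) := fun c n =>
    Nat.rec {[c]} (fun _ L => {l | ∃ l' ∈ L, ∃ P ∈ Ch l', l = P :: l'}) n
  have hlayer0 : ∀ c, layer c 0 = {[c]} := fun c => rfl
  have hlayerS : ∀ c n, layer c (n + 1) = {l | ∃ l' ∈ layer c n, ∃ P ∈ Ch l', l = P :: l'} :=
    fun c n => rfl
  have hchain : ∀ c ∈ Ch [], ∀ n, ∀ l ∈ layer c n, StoppingChain Ch l ∧ l.length = n + 1 := by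
    intro c hc n
    induction n with
    | zero =>
      rintro l hl
      rw [hlayer0, mem_singleton_iff] at hl
      subst hl
      exact ⟨⟨hc, trivial⟩, rfl⟩
    | succ n ih =>
      rintro _ ⟨l', hl', P, hP, rfl⟩
      exact ⟨⟨hP, (ih l' hl').1⟩, by simp [(ih l' hl').2]⟩
  let V : ι → ℕ → Set S := fun c n => ⋃ l ∈ layer c n, headCarrier carrier l
  have hVhalf : ∀ c ∈ Ch [], ∀ n, 2 * μ (V c (n + 1)) ≤ μ (V c n) := by
    intro c hc n
    have hsub : V c (n + 1) ⊆ ⋃ l ∈ layer c n, ⋃ P ∈ Ch l, carrier P := by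
      refine iUnion₂_subset ?_
      rintro _ ⟨l', hl', P, hP, rfl⟩ s hs
      exact mem_iUnion₂.2 ⟨l', hl', mem_iUnion₂.2 ⟨P, hP, hs⟩⟩
    have hdisj : (layer c n).PairwiseDisjoint (headCarrier carrier) := by
      intro l hl l' hl' hne
      refine Set.disjoint_left.2 fun s hs hs' => hne ?_
      obtain ⟨h1, h2⟩ := hchain c hc n l hl
      obtain ⟨h1', h2'⟩ := hchain c hc n l' hl'
      exact h.eq_of_length_eq h1 h1' (h.mem_of_mem_head h1 hs) (h.mem_of_mem_head h1' hs')
        (h2.trans h2'.symm)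
    have hne : ∀ l ∈ layer c n, l ≠ [] := fun l hl h0 => by
      have := (hchain c hc n l hl).2
      rw [h0] at this
      simp at this
    have hmeas : ∀ l ∈ layer c n, MeasurableSet (headCarrier carrier l) := by
      intro l hl
      cases l with
      | nil => exact MeasurableSet.univ
      | cons P l => exact hm P
    calc 2 * μ (V c (n + 1)) ≤ 2 * ∑' l : layer c n, μ (⋃ P ∈ Ch l.1, carrier P) := by
          gcongr
          exact (measure_mono hsub).trans (measure_biUnion_le μ (to_countable _) _)
      _ = ∑' l : layer c n, 2 * μ (⋃ P ∈ Ch l.1, carrier P) := ENNReal.tsum_mul_left.symm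
      _ ≤ ∑' l : layer c n, μ (headCarrier carrier l.1) :=
          ENNReal.tsum_le_tsum fun l => hhalf l.1 (hne l.1 l.2)
      _ = μ (V c n) := (measure_biUnion (to_countable _) hdisj hmeas).symm
  have hVpow : ∀ c ∈ Ch [], ∀ n : ℕ, 2 ^ n * μ (V c n) ≤ μ (carrier c) := by
    intro c hc n
    induction n with
    | zero => simp [V, hlayer0, headCarrier]
    | succ n ih =>
      calc 2 ^ (n + 1) * μ (V c (n + 1)) = 2 ^ n * (2 * μ (V c (n + 1))) := by ring
        _ ≤ 2 ^ n * μ (V c n) := by gcongr; exact hVhalf c hc n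
        _ ≤ _ := ih
  have hnull : ∀ c ∈ Ch [], μ (⋂ n, V c n) = 0 := by
    intro c hc
    by_contra hne
    have hbd : ∀ n : ℕ, (n : ℝ≥0∞) ≤ μ (carrier c) / μ (⋂ n, V c n) := by
      intro n
      refine ENNReal.le_div_iff_mul_le (Or.inl hne) (Or.inr (hfin c)) |>.2 ?_
      refine le_trans ?_ (hVpow c hc n)
      gcongr
      · exact_mod_cast Nat.lt_two_pow_self.le
      · exact iInter_subset _ n
    have htop : μ (carrier c) / μ (⋂ n, V c n) = ∞ := ENNReal.eq_top_of_forall_nnreal_le fun r =>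
      le_trans (by exact_mod_cast Nat.le_ceil r) (hbd ⌈r⌉₊)
    exact ENNReal.div_ne_top (hfin c) hne htop
  have hae : ∀ᵐ s ∂μ, ∀ c ∈ Ch [], s ∉ ⋂ n, V c n :=
    (ae_ball_iff (to_countable _)).2 fun c hc => measure_eq_zero_iff_ae_notMem.1 (hnull c hc)
  filter_upwards [hae] with s hs
  by_contra! hcon
  obtain ⟨c, hc, hsc⟩ := h.top s
  refine hs c hc (mem_iInter.2 fun n => ?_)
  induction n with
  | zero => exact mem_iUnion₂.2 ⟨[c], rfl, hsc⟩
  | succ n ih =>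
    obtain ⟨l, hl, hsl⟩ := mem_iUnion₂.1 ih
    obtain ⟨h1, h2⟩ := hchain c hc n l hl
    have h3 := hcon l (fun h0 => by rw [h0] at h2; simp at h2) h1
    rw [remainder, mem_sdiff, not_and_not_right] at h3
    obtain ⟨P, hP, hsP⟩ := mem_iUnion₂.1 (h3 hsl)
    exact mem_iUnion₂.2 ⟨P :: l, ⟨l, hl, P, hP, rfl⟩, hsP⟩

-- Each member of a chain is among sets covering at most half of the preceding head, and all older
-- members contain that head.
omit [Countable ι] in
lemma pairwise_measure
    (hhalf : ∀ l, l ≠ [] → 2 * μ (⋃ P ∈ Ch l, carrier P) ≤ μ (headCarrier carrier l))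
    {l : List ι} (hl : StoppingChain Ch l) :
    l.Pairwise fun P Q => 2 * μ (carrier P) ≤ μ (carrier Q) := by
  induction l with
  | nil => exact List.Pairwise.nil
  | cons P l ih =>
    refine List.Pairwise.cons (fun Q hQ => ?_) (ih hl.2)
    calc 2 * μ (carrier P) ≤ 2 * μ (⋃ P ∈ Ch l, carrier P) := by
          gcongr
          exact subset_iUnion₂_of_subset P hl.1 Subset.rfl
      _ ≤ μ (headCarrier carrier l) := hhalf l (List.ne_nil_of_mem hQ)
      _ ≤ μ (carrier Q) := measure_mono fun s hs => h.mem_of_mem_head hl.2 hs Q hQ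

end IsStoppingRule

end Chains

/-! ### Multiplicities along a chain -/

section Counting

lemma two_pow_length_mul_le {ι : Type*} {m : ι → ℝ≥0∞} {b : ℝ≥0∞} {P : ι} {l : List ι}
    (hl : (P :: l).Pairwise fun P Q => 2 * m P ≤ m Q) (hb : ∀ Q ∈ P :: l, m Q ≤ b) :
    2 ^ l.length * m P ≤ b := by
  induction l generalizing P with
  | nil => simpa using hb P
  | cons Q l ih =>
    calc 2 ^ (Q :: l).length * m P = 2 ^ l.length * (2 * m P) := by
          rw [List.length_cons]; ring
      _ ≤ 2 ^ l.length * m Q := by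
          gcongr
          exact (List.pairwise_cons.1 hl).1 Q List.mem_cons_self
      _ ≤ b := ih (List.pairwise_cons.1 hl).2 fun Q' hQ' => hb Q' (List.mem_cons_of_mem _ hQ')

/-- Measures double along the list but all lie between `b / D` and `b`, so `2 ^ (length - 1) ≤ D < 2
^ N`. -/
lemma length_le_of_pairwise {ι : Type*} {m : ι → ℝ≥0∞} {b : ℝ≥0∞} {D : ℝ≥0} {N : ℕ}
    (hN : D < 2 ^ N) {l : List ι} (hl : l.Pairwise fun P Q => 2 * m P ≤ m Q)
    (hb : ∀ Q ∈ l, m Q ≤ b ∧ b ≤ D * m Q) (h0 : ∀ Q ∈ l, m Q ≠ 0 ∧ m Q ≠ ∞) : l.length ≤ N := by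
  cases l with
  | nil => simp
  | cons P l =>
    have hP := h0 P List.mem_cons_self
    have h1 := (two_pow_length_mul_le hl fun Q hQ => (hb Q hQ).1).trans
      (hb P List.mem_cons_self).2
    rw [ENNReal.mul_le_mul_iff_left hP.1 hP.2] at h1
    have h2 : (2 : ℝ≥0) ^ l.length ≤ D := by exact_mod_cast h1
    exact (pow_lt_pow_iff_right₀ one_lt_two).1 (h2.trans_lt hN)

-- Different `c` may share the same `R c`; each value is then counted at most `N` times.
open Classical in
lemma sum_map_le_mul_tsum {ι κ : Type*} {l : List ι} {R : ι → κ} {N : ℕ} {𝒮 : Set κ}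
    (hR : ∀ c ∈ l, R c ∈ 𝒮)
    (hN : ∀ x, (l.filter fun c => R c = x).length ≤ N) (v : κ → ℝ≥0∞) :
    (l.map fun c => v (R c)).sum ≤ N * ∑' x : 𝒮, v x := by
  have h1 : (l.map fun c => v (R c)).sum = ((l.map R).map v).sum := by
    rw [List.map_map]; rfl
  rw [h1, Finset.sum_list_map_count]
  have hcount : ∀ x, (l.map R).count x ≤ N := by
    intro x
    refine le_trans (le_of_eq ?_) (hN x)
    rw [List.count, List.countP_map, List.countP_eq_length_filter]
    congr 2
  calc ∑ x ∈ (l.map R).toFinset, (l.map R).count x • v x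
      ≤ ∑ x ∈ (l.map R).toFinset, N * 𝒮.indicator v x := by
        refine Finset.sum_le_sum fun x hx => ?_
        have hx' : x ∈ 𝒮 := by
          obtain ⟨c, hc, rfl⟩ := List.mem_map.1 (List.mem_toFinset.1 hx)
          exact hR c hc
        rw [indicator_of_mem hx', nsmul_eq_mul]
        gcongr
        exact hcount x
    _ = N * ∑ x ∈ (l.map R).toFinset, 𝒮.indicator v x := (Finset.mul_sum _ _ _).symm
    _ ≤ N * ∑' x, 𝒮.indicator v x := by gcongr; exact ENNReal.sum_le_tsum _
    _ = N * ∑' x : 𝒮, v x := by rw [tsum_subtype]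

end Counting

/-! ### Splitting a function along a chain -/

section Pieces

variable {S X ι : Type*} [NormedAddCommGroup X]

/-- The restriction of `f` to the sets `W P`, where `P` runs through a list. -/
noncomputable def residual (W : ι → Set S) (f : S → X) : List ι → S → X
  | [] => f
  | P :: l => (W P).indicator (residual W f l)

/-- The parts of `f` that are cut off successively on the way to `residual W f l`. -/
noncomputable def pieces (W : ι → Set S) (f : S → X) : List ι → List (S → X)
  | [] => []
  | P :: l => (W P)ᶜ.indicator (residual W f l) :: pieces W f l

variable (W : ι → Set S) (f : S → X)

lemma residual_add_sum_pieces (l : List ι) : residual W f l + (pieces W f l).sum = f := by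
  induction l with
  | nil => simp [residual, pieces]
  | cons P l ih =>
    rw [residual, pieces, List.sum_cons, ← add_assoc, indicator_self_add_compl, ih]

lemma support_residual_subset (l : List ι) :
    Function.support (residual W f l) ⊆ Function.support f := by
  induction l with
  | nil => exact Subset.rfl
  | cons P l ih =>
    rw [residual, support_indicator]
    exact inter_subset_right.trans ih

lemma support_subset_of_mem_pieces (l : List ι) {g : S → X} (hg : g ∈ pieces W f l) :
    Function.support g ⊆ Function.support f := by
  induction l with
  | nil => simp [pieces] at hg
  | cons P l ih =>
    rcases List.mem_cons.1 hg with rfl | hg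
    · rw [support_indicator]
      exact inter_subset_right.trans (support_residual_subset W f l)
    · exact ih hg

/-- Each new set splits the current residual in two, and that residual is already disjoint from all
earlier pieces. No nesting of the sets `W P` is required. -/
lemma pairwise_disjoint_pieces (l : List ι) : (residual W f l :: pieces W f l).Pairwise
    fun g h => Disjoint (Function.support g) (Function.support h) := by
  induction l with
  | nil => simp [pieces]
  | cons P l ih =>
    obtain ⟨h1, h2⟩ := List.pairwise_cons.1 ih
    rw [residual, pieces]
    refine List.Pairwise.cons ?_ (List.Pairwise.cons (fun g hg => ?_) h2)
    · intro g hg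
      rw [support_indicator]
      rcases List.mem_cons.1 hg with rfl | hg
      · rw [support_indicator]
        exact disjoint_compl_right.mono inter_subset_left inter_subset_left
      · exact (h1 g hg).mono_left inter_subset_right
    · rw [support_indicator]
      exact (h1 g hg).mono_left inter_subset_right

lemma enorm_residual_le (l : List ι) (s : S) : ‖residual W f l s‖ₑ ≤ ‖f s‖ₑ := by
  induction l with
  | nil => exact le_rfl
  | cons P l ih => exact (enorm_indicator_le_enorm_self _ _).trans ih

variable {W f} [MeasurableSpace S] {μ : Measure S} {p : ℝ≥0∞}

lemma memLp_residual (hW : ∀ P, MeasurableSet (W P)) (hf : MemLp f p μ) (l : List ι) :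
    MemLp (residual W f l) p μ := by
  induction l with
  | nil => exact hf
  | cons P l ih => exact ih.indicator (hW P)

lemma memLp_of_mem_pieces (hW : ∀ P, MeasurableSet (W P)) (hf : MemLp f p μ) (l : List ι)
    {g : S → X} (hg : g ∈ pieces W f l) : MemLp g p μ := by
  induction l with
  | nil => simp [pieces] at hg
  | cons P l ih =>
    rcases List.mem_cons.1 hg with rfl | hg
    · exact (memLp_residual hW hf l).indicator (hW P).compl
    · exact ih hg

end Pieces

/-! ### The initial partition -/

section TopCubes

variable {S X : Type*} [Zero X] {d : S → S → ℝ} {c_d c_μ c₀ C₀ δ : ℝ} {𝒟 : ℤ → Set (Set S)}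
  [MeasurableSpace S] {μ : Measure S}

omit [MeasurableSpace S] in
lemma BoundedlySupported.exists_dist_le [Nonempty S] {f : S → X} (hf : BoundedlySupported d f) :
    ∃ (s : S) (R : ℝ), ∀ t ∈ Function.support f, d s t ≤ R := by
  obtain ⟨R, hR⟩ := hf
  rcases (Function.support f).eq_empty_or_nonempty with h0 | ⟨s, hs⟩
  · exact ⟨Classical.arbitrary S, 0, by simp [h0]⟩
  · exact ⟨s, R, hR s hs⟩

/-- A partition into cubes whose dilates contain the support of a given function. -/
lemma IsDyadicSystem.exists_top_cubes [Nonempty S] (h : IsDyadicSystem d c₀ C₀ δ 𝒟)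
    (hS : IsHomogeneousType d μ c_d c_μ) (hc₀ : 0 < c₀) (hC₀ : 0 < C₀) (hδ : 0 < δ) (hδ1 : δ < 1)
    {α : ℝ} (hα : 3 * c_d ^ 2 / δ ≤ α) {f : S → X} (hf : BoundedlySupported d f) :
    ∃ 𝒯 : Set (Cube 𝒟),
      (∀ P ∈ 𝒯, ∀ P' ∈ 𝒯, ∀ s, s ∈ P.carrier → s ∈ P'.carrier → P = P') ∧
      (∀ s, ∃ P ∈ 𝒯, s ∈ P.carrier) ∧ ∀ P ∈ 𝒯, Function.support f ⊆ h.dilate α P := by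
  have hq := hS.isQuasiMetric
  have hc := hq.pos
  have hc1 := hq.one_le
  obtain ⟨s₀, R, hR⟩ := hf.exists_dist_le
  -- The cubes that are too small for the support, with a safety margin. The summand `1` makes all
  -- very small cubes satisfy `p`, and `s₀` does the same if `f = 0`; large cubes through a fixed
  -- point fail it. So maximal cubes with `p` exist, and the parent of one reaches the whole
  -- support, which costs the factor `3 * c_d ^ 2 / δ`.
  let p : Cube 𝒟 → Prop := fun P => ¬ ∀ y ∈ insert s₀ (Function.support f),
    d (h.centre P) y + 1 < 2 * c_d * (C₀ * δ ^ P.1)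
  refine ⟨maximalCubes p, fun P hP P' hP' s hs hs' => h.eq_of_mem_maximalCubes hP hP' hs hs',
    fun s => exists_mem_maximalCubes ?_ ?_, fun P hP => ?_⟩
  · obtain ⟨k, -, hk⟩ := exists_zpow_lt hδ hδ1 0 (ε := 1 / (2 * c_d * C₀)) (by positivity)
    obtain ⟨P, rfl, hs⟩ := h.exists_cube k s
    refine ⟨P, hs, fun hcon => ?_⟩
    have h1 := hcon s₀ (mem_insert _ _)
    rw [lt_div_iff₀ (by positivity)] at hk
    have h2 := hq.nonneg (h.centre P) s₀
    linarith
  · set K : ℝ := c_d * (c_d * (d s s₀ + max R 0)) + 1 with hK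
    have hK0 : 0 < K := by
      have := hq.nonneg s s₀
      positivity
    obtain ⟨l, -, hl⟩ := exists_zpow_lt hδ hδ1 0 (ε := c_d * C₀ / K) (by positivity)
    refine ⟨-l, fun P hs hP => ?_⟩
    simp only [p, not_forall, not_lt] at hP
    obtain ⟨y, hy, hle⟩ := hP
    have h1 : d s₀ y ≤ max R 0 := by
      rcases hy with rfl | hy
      · rw [hq.self_eq_zero]; exact le_max_right _ _
      · exact (hR y hy).trans (le_max_left _ _)
    have h2 : d s y ≤ c_d * (d s s₀ + max R 0) :=
      (hq.quasi_triangle s y s₀).trans (by gcongr)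
    have h3 : d (h.centre P) y ≤ c_d * (C₀ * δ ^ P.1 + c_d * (d s s₀ + max R 0)) := by
      refine (hq.quasi_triangle _ y s).trans ?_
      gcongr
      exact (h.subset_qball P hs).le
    have h4 : c_d * C₀ * δ ^ P.1 ≤ K := by
      rw [hK]; linarith
    by_contra! hlt
    have h5 : δ ^ (-l) ≤ δ ^ P.1 := zpow_le_zpow_right_of_le_one₀ hδ hδ1.le hlt.le
    rw [lt_div_iff₀ hK0] at hl
    have h6 : δ ^ (-l) * δ ^ l = 1 := by rw [← zpow_add₀ hδ.ne']; simp
    have hpl := zpow_pos hδ l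
    have h7 : c_d * C₀ * δ ^ (-l) ≤ K := le_trans (by gcongr) h4
    have h8 : c_d * C₀ * δ ^ (-l) * δ ^ l ≤ K * δ ^ l := by gcongr
    rw [mul_assoc, h6, mul_one] at h8
    linarith
  · have hz := h.centre_mem hS hc₀ hδ P
    obtain ⟨P', hP'1, hzP'⟩ := h.exists_cube (P.1 - 1) (h.centre P)
    have hPP' : P.carrier ⊆ P'.carrier := h.subset_of_mem (by omega) hz hzP'
    have hnp := not_not.1 (hP.2 P' (by omega) hPP')
    intro y hy
    have h1 : d (h.centre P) (h.centre P') < C₀ * δ ^ P'.1 := by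
      rw [hq.symm]; exact h.subset_qball P' hzP'
    have h2 : d (h.centre P') y < 2 * c_d * (C₀ * δ ^ P'.1) := by
      have := hnp y (mem_insert_of_mem _ hy)
      linarith
    refine (hq.triangle_lt h1 h2).trans_le ?_
    have hpow : δ ^ P.1 = δ ^ P'.1 * δ := by
      rw [← zpow_add_one₀ hδ.ne', hP'1, sub_add_cancel]
    have := zpow_pos hδ P'.1
    calc c_d * (C₀ * δ ^ P'.1 + 2 * c_d * (C₀ * δ ^ P'.1))
        ≤ c_d * (c_d * (C₀ * δ ^ P'.1) + 2 * c_d * (C₀ * δ ^ P'.1)) := by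
          refine mul_le_mul_of_nonneg_left (add_le_add_left ?_ _) hc.le
          exact le_mul_of_one_le_left (by positivity) hc1
      _ = 3 * c_d ^ 2 / δ * (C₀ * δ ^ P.1) := by rw [hpow]; field_simp; norm_num
      _ ≤ α * (C₀ * δ ^ P.1) := by
          rw [hpow]
          gcongr

end TopCubes

/-! ### Sparse families and the domination estimate -/

section SparseDomination

/-- Bounding the sum by twice the larger term keeps the `2` inside the `r`-th power, so it survives
the later `r`-th root as a constant free of `r`. -/
lemma rpow_add_le_mul {r : ℝ} (hr : 0 ≤ r) (K a b : ℝ≥0∞) :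
    (K * (a + b)) ^ r ≤ (2 * K) ^ r * (a ^ r + b ^ r) := by
  wlog hab : a ≤ b generalizing a b
  · rw [add_comm a, add_comm (a ^ r)]
    exact this b a (le_of_not_ge hab)
  calc (K * (a + b)) ^ r ≤ (2 * K * b) ^ r := by
        refine ENNReal.rpow_le_rpow ?_ hr
        rw [show 2 * K * b = K * (b + b) by ring]
        gcongr
    _ = (2 * K) ^ r * b ^ r := ENNReal.mul_rpow_of_nonneg _ _ hr
    _ ≤ _ := by gcongr; exact le_add_self

lemma rpow_mul_rpow_inv_le {r : ℝ} (hr : 1 ≤ r) {n : ℝ≥0∞} (hn : 1 ≤ n) (K s : ℝ≥0∞) :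
    (n * K ^ r * s) ^ (1 / r) ≤ n * K * s ^ (1 / r) := by
  have hr0 : 0 < r := one_pos.trans_le hr
  rw [ENNReal.mul_rpow_of_nonneg _ _ (by positivity), ENNReal.mul_rpow_of_nonneg _ _ (by positivity),
    ← ENNReal.rpow_mul, mul_one_div_cancel hr0.ne', ENNReal.rpow_one]
  gcongr
  conv_rhs => rw [← ENNReal.rpow_one n]
  exact ENNReal.rpow_le_rpow_of_exponent_le hn (by rw [div_le_one hr0]; exact hr)

variable {S : Type*} {d : S → S → ℝ} {c_d c_μ c₀ C₀ δ γ : ℝ} [MeasurableSpace S] {μ : Measure S}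

/-- A cube of one of the adjacent systems that contains a dilate of `c`. -/
lemma IsAdjacentDyadicFamily.exists_cube_superset {m : ℕ} {𝒟 : Fin m → ℤ → Set (Set S)}
    (h : IsAdjacentDyadicFamily d c₀ C₀ δ γ 𝒟) (hC₀ : 0 < C₀) (hδ : 0 < δ) (hγ : 1 ≤ γ)
    (hS : IsHomogeneousType d μ c_d c_μ) {α : ℝ} (hα : 0 < α) (j : Fin m) (c : Cube (𝒟 j)) :
    ∃ R : Set S, (∃ j k, R ∈ 𝒟 j k) ∧ (h.isDyadicSystem j).dilate α c ⊆ R ∧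
      R ⊆ (h.isDyadicSystem j).dilate (2 * γ * α) c := by
  have hρ : 0 < α * (C₀ * δ ^ c.1) := mul_pos hα (mul_pos hC₀ (zpow_pos hδ _))
  obtain ⟨j', k, R, hR, h1, h2⟩ := h.adjacent ((h.isDyadicSystem j).centre c) _ hρ
  refine ⟨R, ⟨j', k, hR⟩, h1, fun x hx => ?_⟩
  have h3 := h2 _ (h1 (hS.isQuasiMetric.mem_qball_self _ hρ)) x hx
  -- Balls are defined by a strict inequality, and the diameter bound is not strict; hence `2 * γ`
  -- and not `γ`.
  refine h3.trans_lt ?_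
  have : 0 < γ * (α * (C₀ * δ ^ c.1)) := mul_pos (by linarith) hρ
  linarith

/-- The collection of the sets `R c`, where `c` is the head of a chain, is sparse. -/
lemma IsStoppingRule.isSparse {ι : Type*} [Countable ι] {carrier : ι → Set S}
    {Ch : List ι → Set ι} (h : IsStoppingRule carrier Ch) (hm : ∀ P, MeasurableSet (carrier P))
    (hfin : ∀ P, μ (carrier P) ≠ ∞)
    (hhalf : ∀ l, l ≠ [] → 2 * μ (⋃ P ∈ Ch l, carrier P) ≤ μ (headCarrier carrier l))
    {R : ι → Set S} (hR : ∀ c, carrier c ⊆ R c) {D : ℝ≥0} (hD1 : 1 ≤ D)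
    (hD : ∀ c, μ (R c) ≤ D * μ (carrier c)) :
    IsSparse μ (1 / (2 * D)) (R '' {c | ∃ l, StoppingChain Ch (c :: l)}) := by
  -- One chain is fixed for each set `Q`, although several may lead to it. Different sets get chains
  -- with different heads, so their remainders are disjoint.
  have hex : ∀ Q : Set S, ∃ l : List ι, Q ∈ R '' {c | ∃ l, StoppingChain Ch (c :: l)} →
      StoppingChain Ch l ∧ l ≠ [] ∧ ∀ c ∈ l.head?, R c = Q := by
    intro Q
    by_cases hQ : Q ∈ R '' {c | ∃ l, StoppingChain Ch (c :: l)}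
    · obtain ⟨c, ⟨l, hl⟩, rfl⟩ := hQ
      exact ⟨c :: l, fun _ => ⟨hl, by simp, by simp⟩⟩
    · exact ⟨[], fun h => absurd h hQ⟩
  choose L hL using hex
  refine ⟨fun Q => remainder carrier Ch (L Q), fun Q hQ => ?_, fun Q hQ Q' hQ' hne => ?_⟩
  · obtain ⟨h1, h2, h3⟩ := hL Q hQ
    have h4 := h.measure_head_le hm hfin hhalf h2
    refine ⟨?_, ?_, ?_⟩
    · refine MeasurableSet.diff ?_ (MeasurableSet.biUnion (to_countable _) fun P _ => hm P)
      cases hl : L Q with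
      | nil => exact MeasurableSet.univ
      | cons c l => exact hm c
    · cases hl : L Q with
      | nil => exact absurd hl h2
      | cons c l =>
        refine sdiff_subset.trans ?_
        rw [hl, ← h3 c (by simp [hl])]
        exact hR c
    · have h5 : μ Q ≤ D * μ (headCarrier carrier (L Q)) := by
        cases hl : L Q with
        | nil => exact absurd hl h2
        | cons c l =>
          rw [← h3 c (by simp [hl])]
          exact hD c
      have hD0 : 0 < D := one_pos.trans_le hD1
      have h6 : ENNReal.ofReal (1 / (2 * D)) * (2 * D) = 1 := by
        rw [show (2 * D : ℝ≥0∞) = ENNReal.ofReal (2 * D) by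
          rw [ENNReal.ofReal_mul (by norm_num)]; simp,
          ← ENNReal.ofReal_mul (by positivity), one_div_mul_cancel (by positivity),
          ENNReal.ofReal_one]
      calc ENNReal.ofReal (1 / (2 * D)) * μ Q
          ≤ ENNReal.ofReal (1 / (2 * D)) * (D * (2 * μ (remainder carrier Ch (L Q)))) := by
            gcongr
            exact h5.trans (by gcongr)
        _ = ENNReal.ofReal (1 / (2 * D)) * (2 * D) * μ (remainder carrier Ch (L Q)) := by ring
        _ = _ := by rw [h6, one_mul]
  · obtain ⟨h1, h2, h3⟩ := hL Q hQ
    obtain ⟨h1', h2', h3'⟩ := hL Q' hQ'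
    refine h.disjoint_remainder h1 h1' fun heq => hne ?_
    cases hl : L Q with
    | nil => exact absurd hl h2
    | cons c l =>
      rw [← h3 c (by simp [hl]), ← h3' c (by simp [← heq, hl])]

variable {X Y 𝕜 : Type*} [RCLike 𝕜]
  [NormedAddCommGroup X] [NormedSpace 𝕜 X] [NormedAddCommGroup Y] [NormedSpace 𝕜 Y]
  {p₁ p₂ r : ℝ} {T : Lp X (ENNReal.ofReal p₁) μ →ₗ[𝕜] (S →ₘ[μ] Y)}

/-- The pointwise sum over the pieces that belong to a chain of stopping cubes. -/
lemma sum_pieces_add_le {ι : Type*} {W carrier : ι → Set S} {Ch : List ι → Set ι} {f : S → X}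
    {a : ι → ℝ≥0∞} {K : ℝ≥0∞} (hr : 0 < r) {s : S}
    (htop : ∀ P ∈ Ch [], ‖applyFun T ((W P)ᶜ.indicator f) s‖ₑ = 0)
    (hstep : ∀ c l, ∀ P ∈ Ch (c :: l), s ∈ carrier P →
      ‖applyFun T ((W P)ᶜ.indicator (residual W f (c :: l))) s‖ₑ ≤ K * (a c + a P))
    {c : ι} {l : List ι} (hl : StoppingChain Ch (c :: l))
    (hs : ∀ P ∈ c :: l, s ∈ carrier P) :
    ((pieces W f (c :: l)).map fun g => ‖applyFun T g s‖ₑ ^ r).sum + (2 * K) ^ r * a c ^ r ≤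
      2 * (2 * K) ^ r * ((c :: l).map fun c => a c ^ r).sum := by
  induction l generalizing c with
  | nil =>
    simp only [pieces, residual, List.map_cons, List.map_nil, List.sum_cons, List.sum_nil,
      add_zero, htop c hl.1, ENNReal.zero_rpow_of_pos hr, zero_add]
    rw [mul_assoc]
    exact le_mul_of_one_le_left zero_le one_le_two
  | cons c' l ih =>
    have h1 := ih hl.2 fun P hP => hs P (List.mem_cons_of_mem _ hP)
    have h2 := hstep c' l c hl.1 (hs c List.mem_cons_self)
    -- The piece cut off at `c` costs a term in `a c'` as well; the additional summand on the left
    -- of the induction hypothesis pays for it.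
    have h3 := (ENNReal.rpow_le_rpow h2 hr.le).trans (rpow_add_le_mul hr.le K (a c') (a c))
    rw [pieces, List.map_cons, List.sum_cons, List.map_cons (l := c' :: l), List.sum_cons]
    set A₁ := ((pieces W f (c' :: l)).map fun g => ‖applyFun T g s‖ₑ ^ r).sum
    set A₂ := ((c' :: l).map fun c => a c ^ r).sum
    calc _ ≤ (2 * K) ^ r * (a c' ^ r + a c ^ r) + A₁ + (2 * K) ^ r * a c ^ r := by gcongr
      _ = 2 * (2 * K) ^ r * a c ^ r + (A₁ + (2 * K) ^ r * a c' ^ r) := by ring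
      _ ≤ 2 * (2 * K) ^ r * a c ^ r + 2 * (2 * K) ^ r * A₂ := by gcongr
      _ = _ := by ring

theorem IsAdjacentDyadicFamily.exists_sparse_domination [Nonempty S] {m : ℕ}
    {𝒟 : Fin m → ℤ → Set (Set S)} (h𝒟 : IsAdjacentDyadicFamily d c₀ C₀ δ γ 𝒟)
    (hpar : AdmissibleParams c₀ C₀ δ γ) (hS : IsHomogeneousType d μ c_d c_μ)
    {α : ℝ} (hα : 3 * c_d ^ 2 / δ ≤ α) {D : ℝ≥0}
    (hD : D = doublingConst c_μ (2 * γ * α * C₀ / c₀)) {N : ℕ} (hN : D < 2 ^ N)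
    (hp₁ : 1 ≤ p₁) (hp₂ : 1 ≤ p₂) (hr : 1 ≤ r)
    (hA : opNorm T < ∞) (hM : sharpMaximalNorm d α p₂ T < ∞) {C_r : ℝ} (hC_r : 0 < C_r)
    (hT : IsSublinear d (max p₁ p₂) r C_r T) {f : S → X}
    (hf : MemLp f (ENNReal.ofReal (max p₁ p₂)) μ) (hfs : BoundedlySupported d f) :
    ∃ 𝒮 : Set (Set S), (∀ Q ∈ 𝒮, ∃ j k, Q ∈ 𝒟 j k) ∧ IsSparse μ (1 / (2 * D)) 𝒮 ∧
      ∀ᵐ s ∂μ, ‖applyFun T f s‖ₑ ≤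
        (2 * N * (2 * (24 * D ^ 2)) * D : ℝ≥0) * (opNorm T + sharpMaximalNorm d α p₂ T) *
          ENNReal.ofReal C_r *
          (∑' Q : 𝒮, (Q : Set S).indicator
            (fun _ => average μ (max p₁ p₂) (Q : Set S) f ^ r) s) ^ (1 / r) := by
  have hq := hS.isQuasiMetric
  have hc1 := hq.one_le
  have hc₀ := hpar.c₀_pos
  have hC₀ : 0 < C₀ := hc₀.trans_le hpar.c₀_le
  have hδ := hpar.δ_pos
  have hδ1 := hpar.δ_lt_one
  have hγ := hpar.one_le_γ
  have hα2 : 2 * c_d / δ ≤ α := by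
    refine le_trans ?_ hα
    gcongr ?_ / δ
    nlinarith
  have hα1 : 1 ≤ α := by
    refine le_trans ?_ hα2
    rw [le_div_iff₀ hδ]
    linarith
  have hα0 : 0 < α := one_pos.trans_le hα1
  have hD1 : 1 ≤ D := hD ▸ one_le_doublingConst _ _
  have hr0 : 0 < r := one_pos.trans_le hr
  have hp₀ : 1 ≤ max p₁ p₂ := hp₁.trans (le_max_left _ _)
  obtain ⟨j⟩ : Nonempty (Fin m) := by
    obtain ⟨j, -⟩ := h𝒟.adjacent (Classical.arbitrary S) 1 one_pos
    exact ⟨j⟩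
  have h := h𝒟.isDyadicSystem j
  have hcount := h.countable_cube hS hc₀ hδ
  set W : Cube (𝒟 j) → Set S := h.dilate α with hW
  choose R hR𝒟 hWR hRW using h𝒟.exists_cube_superset hC₀ hδ hγ hS hα0 j
  have hRμ : ∀ c, μ (R c) ≤ D * μ c.carrier := fun c =>
    (measure_mono (hRW c)).trans (hD ▸ h.measure_dilate_le hS hc₀ hδ _ c)
  have hQW : ∀ c : Cube (𝒟 j), c.carrier ⊆ W c := fun c => h.carrier_subset_dilate hα1 hC₀ hδ c
  have hWμ : ∀ c, μ (W c) ≤ D * μ c.carrier := fun c => (measure_mono (hWR c)).trans (hRμ c)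
  have hWm : ∀ c, MeasurableSet (W c) := fun c => h.measurableSet_dilate hS hα0 hC₀ hδ c
  have hQ0 : ∀ c : Cube (𝒟 j), μ c.carrier ≠ 0 := fun c => (h.measure_carrier_pos hS hc₀ hδ c).ne'
  have hQt : ∀ c : Cube (𝒟 j), μ c.carrier ≠ ∞ :=
    fun c => (h.measure_carrier_lt_top hS hC₀ hδ c).ne
  have hRt : ∀ c, μ (R c) ≠ ∞ := fun c =>
    ((hRμ c).trans_lt (ENNReal.mul_lt_top ENNReal.coe_lt_top (hQt c).lt_top)).ne
  obtain ⟨𝒯, h𝒯1, h𝒯2, h𝒯3⟩ := h.exists_top_cubes hS hc₀ hC₀ hδ hδ1 hα hfs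
  -- The stopping cubes depend on the whole chain through the residual, which is why chains and not
  -- single cubes are iterated.
  have hfamily := fun (c : Cube (𝒟 j)) (l : List (Cube (𝒟 j))) =>
    h.exists_stopping_family hS hc₀ hC₀ hδ hδ1 hα1 hα2 hD1 hWμ hp₁ hp₂ hA hM c
      (g := residual W f (c :: l)) (memLp_residual hWm hf _) support_indicator_subset
  choose 𝒞 h𝒞1 h𝒞2 h𝒞3 h𝒞4 h𝒞5 using hfamily
  set κ : ℝ≥0 := 24 * D ^ 2
  set CT := opNorm T + sharpMaximalNorm d α p₂ T
  set a : Cube (𝒟 j) → ℝ≥0∞ := fun c => average μ (max p₁ p₂) (W c) f with ha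
  have hres : ∀ c l, average μ (max p₁ p₂) (W c) (residual W f l) ≤ a c := fun c l =>
    average_mono_fun (one_pos.trans_le hp₀) (enorm_residual_le W f l)
  let Ch : List (Cube (𝒟 j)) → Set (Cube (𝒟 j)) := fun l => match l with
    | [] => 𝒯
    | c :: l => 𝒞 c l
  have hrule : IsStoppingRule Cube.carrier Ch := by
    refine ⟨fun l => ?_, fun l => ?_, h𝒯2⟩
    · cases l with
      | nil => exact h𝒯1
      | cons c l => exact h𝒞1 c l
    · cases l with
      | nil => exact fun P _ => subset_univ _
      | cons c l => exact h𝒞2 c l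
  have hm : ∀ P : Cube (𝒟 j), MeasurableSet P.carrier := h.measurableSet_carrier
  have hhalf : ∀ l, l ≠ [] →
      2 * μ (⋃ P ∈ Ch l, P.carrier) ≤ μ (headCarrier Cube.carrier l) := by
    intro l hl
    cases l with
    | nil => exact absurd rfl hl
    | cons c l => exact h𝒞3 c l
  refine ⟨R '' {c | ∃ l, StoppingChain Ch (c :: l)}, ?_,
    hrule.isSparse hm hQt hhalf (fun c => (hQW c).trans (hWR c)) hD1 hRμ, ?_⟩
  · rintro _ ⟨c, -, rfl⟩
    exact hR𝒟 c
  have hstep : ∀ᵐ s ∂μ, ∀ c l, ∀ P ∈ Ch (c :: l), s ∈ P.carrier →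
      ‖applyFun T ((W P)ᶜ.indicator (residual W f (c :: l))) s‖ₑ ≤ κ * CT * (a c + a P) := by
    refine ae_all_iff.2 fun c => ae_all_iff.2 fun l => (ae_ball_iff (to_countable _)).2
      fun P hP => ?_
    filter_upwards [h𝒞5 c l P hP] with s hs hsP
    exact (hs hsP).trans (by gcongr <;> exact hres _ _)
  -- The dilate of a top cube contains the support of `f`, so the first cut removes nothing.
  have htop : ∀ᵐ s ∂μ, ∀ P ∈ Ch [], ‖applyFun T ((W P)ᶜ.indicator f) s‖ₑ = 0 := by
    refine (ae_ball_iff (to_countable _)).2 fun P hP => ?_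
    have h0 : (W P)ᶜ.indicator f = 0 :=
      indicator_eq_zero.2 (disjoint_compl_right.mono_left (h𝒯3 P hP))
    rw [h0]
    filter_upwards [applyFun_zero T] with s hs
    simp [hs]
  have hsub : ∀ᵐ s ∂μ, ∀ l : List (Cube (𝒟 j)), ‖applyFun T f s‖ₑ ≤ ENNReal.ofReal C_r *
      (‖applyFun T (residual W f l) s‖ₑ ^ r +
        ((pieces W f l).map fun g => ‖applyFun T g s‖ₑ ^ r).sum) ^ (1 / r) := by
    refine ae_all_iff.2 fun l => ?_
    have hbs : ∀ g : S → X, Function.support g ⊆ Function.support f → BoundedlySupported d g := by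
      obtain ⟨B, hB⟩ := hfs
      exact fun g hg => ⟨B, fun s hs t ht => hB s (hg hs) t (hg ht)⟩
    have h1 := hT.ae_enorm_le hr0 hC_r.le (residual W f l :: pieces W f l) (fun g hg => by
        rcases List.mem_cons.1 hg with rfl | hg
        · exact memLp_residual hWm hf l
        · exact memLp_of_mem_pieces hWm hf l hg) (fun g hg => hbs g <| by
        rcases List.mem_cons.1 hg with rfl | hg
        · exact support_residual_subset W f l
        · exact support_subset_of_mem_pieces W f l hg) (pairwise_disjoint_pieces W f l)
    rwa [List.sum_cons, residual_add_sum_pieces] at h1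
  -- There are countably many chains, so one null set serves for all of them and the chain may
  -- depend on `s`.
  filter_upwards [hstep, htop, hsub, hrule.ae_mem_remainder hm hQt hhalf] with s hstep htop hsub
    ⟨l, hl0, hl, hsl⟩
  obtain ⟨c, l, rfl⟩ := List.exists_cons_of_ne_nil hl0
  have hsmem := hrule.mem_of_mem_head hl hsl.1
  have hsum := sum_pieces_add_le hr0 htop hstep hl hsmem
  set 𝒮 := R '' {c | ∃ l, StoppingChain Ch (c :: l)} with h𝒮
  set v : Set S → ℝ≥0∞ := fun Q =>
    Q.indicator (fun _ => average μ (max p₁ p₂) Q f ^ r) s with hv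
  have hmem𝒮 : ∀ c' ∈ c :: l, R c' ∈ 𝒮 := by
    have : ∀ l', StoppingChain Ch l' → ∀ c' ∈ l', R c' ∈ 𝒮 := by
      intro l'
      induction l' with
      | nil => simp
      | cons P l' ih =>
        intro hl' c' hc'
        rcases List.mem_cons.1 hc' with rfl | hc'
        · exact ⟨_, ⟨l', hl'⟩, rfl⟩
        · exact ih hl'.2 c' hc'
    exact this _ hl
  -- The final residual is estimated off the stopping cubes; it is absorbed by the additional
  -- summand in `hsum`.
  have hlast : ‖applyFun T (residual W f (c :: l)) s‖ₑ ^ r ≤ (2 * (κ * CT)) ^ r * a c ^ r := by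
    rw [← ENNReal.mul_rpow_of_nonneg _ _ hr0.le]
    refine ENNReal.rpow_le_rpow ?_ hr0.le
    have h1 := h𝒞4 c l s hsl.1 fun P hP hsP => hsl.2 (mem_iUnion₂.2 ⟨P, hP, hsP⟩)
    calc _ ≤ κ * (opNorm T * a c) := h1.trans (by gcongr; exact hres _ _)
      _ ≤ κ * (CT * a c) := by gcongr; exact le_self_add
      _ ≤ 2 * (κ * (CT * a c)) := by rw [two_mul]; exact le_self_add
      _ = _ := by ring
  have ha_le : ∀ c' ∈ c :: l, a c' ^ r ≤ (D : ℝ≥0∞) ^ r * v (R c') := by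
    intro c' hc'
    have hsR : s ∈ R c' := hWR c' (hQW c' (hsmem c' hc'))
    rw [hv]
    simp only [indicator_of_mem hsR]
    rw [← ENNReal.mul_rpow_of_nonneg _ _ hr0.le]
    refine ENNReal.rpow_le_rpow ?_ hr0.le
    refine average_le_mul_average hp₀ hD1 (hWR c') (hRt c')
      (fun h0 => hQ0 c' (measure_mono_null (hQW c') h0)) ?_ f
    exact (hRμ c').trans (by gcongr; exact hQW c')
  have hsuma : ((c :: l).map fun c => a c ^ r).sum ≤
      (D : ℝ≥0∞) ^ r * (N * ∑' Q : 𝒮, v Q) := by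
    calc ((c :: l).map fun c => a c ^ r).sum
        ≤ ((c :: l).map fun c => (D : ℝ≥0∞) ^ r * v (R c)).sum :=
          List.sum_le_sum ha_le
      _ = (D : ℝ≥0∞) ^ r * ((c :: l).map fun c => v (R c)).sum := List.sum_map_mul_left _ _ _
      _ ≤ _ := by
          gcongr
          refine sum_map_le_mul_tsum hmem𝒮 (fun x => ?_) v
          -- All members `Q` of the chain with `R Q = x` have measure between `μ x / D` and `μ x`.
          refine length_le_of_pairwise (m := fun c : Cube (𝒟 j) => μ c.carrier) (b := μ x) hN
            ((hrule.pairwise_measure hhalf hl).sublist List.filter_sublist) (fun Q hQ => ?_)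
            fun Q _ => ⟨hQ0 Q, hQt Q⟩
          have hQx : R Q = x := by simpa using (List.mem_filter.1 hQ).2
          rw [← hQx]
          exact ⟨measure_mono ((hQW Q).trans (hWR Q)), hRμ Q⟩
  have hN1 : 1 ≤ (2 * N : ℝ≥0∞) := by
    have : N ≠ 0 := by
      rintro rfl
      rw [pow_zero] at hN
      exact absurd hD1 (not_le.2 hN)
    have h2 : 1 ≤ 2 * N := by omega
    exact_mod_cast h2
  calc ‖applyFun T f s‖ₑ ≤ ENNReal.ofReal C_r *
        (‖applyFun T (residual W f (c :: l)) s‖ₑ ^ r +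
          ((pieces W f (c :: l)).map fun g => ‖applyFun T g s‖ₑ ^ r).sum) ^ (1 / r) :=
        hsub (c :: l)
    _ ≤ ENNReal.ofReal C_r *
        (2 * (2 * (κ * CT)) ^ r * ((D : ℝ≥0∞) ^ r * (N * ∑' Q : 𝒮, v Q))) ^ (1 / r) := by
        gcongr
        calc _ ≤ ((pieces W f (c :: l)).map fun g => ‖applyFun T g s‖ₑ ^ r).sum +
              (2 * (κ * CT)) ^ r * a c ^ r := by rw [add_comm]; gcongr
          _ ≤ _ := hsum.trans (by gcongr)
    _ = ENNReal.ofReal C_r *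
        (2 * N * (2 * (κ * CT) * D) ^ r * ∑' Q : 𝒮, v Q) ^ (1 / r) := by
        rw [ENNReal.mul_rpow_of_nonneg _ (D : ℝ≥0∞) hr0.le]
        congr 2
        ring
    _ ≤ ENNReal.ofReal C_r *
        (2 * N * (2 * (κ * CT) * D) * (∑' Q : 𝒮, v Q) ^ (1 / r)) := by
        gcongr
        exact rpow_mul_rpow_inv_le hr hN1 _ _
    _ = _ := by
        push_cast
        ring

end SparseDomination

end SparseDom

theorem theorem1p1 (c_d c_μ : ℝ) :
    -- adjacent dyadic systems exist, with parameters that depend on `c_d` and `c_μ` only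
    (∃ (c₀ C₀ δ γ : ℝ) (m : ℕ), AdmissibleParams c₀ C₀ δ γ ∧
      ∀ (S : Type u) [MeasurableSpace S] (d : S → S → ℝ) (μ : Measure S),
        IsHomogeneousType d μ c_d c_μ →
        ∃ 𝒟 : Fin m → ℤ → Set (Set S), IsAdjacentDyadicFamily d c₀ C₀ δ γ 𝒟) ∧
    -- sparse domination by cubes of any such family of dyadic systems
    (∀ (c₀ C₀ δ γ : ℝ) (m : ℕ), AdmissibleParams c₀ C₀ δ γ →
      ∀ α : ℝ, 3 * c_d ^ 2 / δ ≤ α →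
      ∃ (η : ℝ) (C : ℝ≥0), 0 < η ∧ η < 1 ∧
        ∀ (S : Type u) [MeasurableSpace S] (d : S → S → ℝ) (μ : Measure S),
          IsHomogeneousType d μ c_d c_μ →
        ∀ 𝒟 : Fin m → ℤ → Set (Set S), IsAdjacentDyadicFamily d c₀ C₀ δ γ 𝒟 →
        ∀ (𝕜 : Type x) [RCLike 𝕜]
          (X : Type v) [NormedAddCommGroup X] [NormedSpace 𝕜 X] [CompleteSpace X]
          (Y : Type w) [NormedAddCommGroup Y] [NormedSpace 𝕜 Y] [CompleteSpace Y]
          (p₁ p₂ r : ℝ), 1 ≤ p₁ → 1 ≤ p₂ → 1 ≤ r →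
        ∀ T : Lp X (ENNReal.ofReal p₁) μ →ₗ[𝕜] (S →ₘ[μ] Y),
          opNorm T < ∞ →
          sharpMaximalNorm d α p₂ T < ∞ →
        ∀ C_r : ℝ, 0 < C_r → IsSublinear d (max p₁ p₂) r C_r T →
        ∀ f : S → X, MemLp f (ENNReal.ofReal (max p₁ p₂)) μ → BoundedlySupported d f →
        ∃ 𝒮 : Set (Set S), (∀ Q ∈ 𝒮, ∃ j k, Q ∈ 𝒟 j k) ∧ IsSparse μ η 𝒮 ∧
          ∀ᵐ s ∂μ, ‖applyFun T f s‖ₑ ≤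
            C * (opNorm T + sharpMaximalNorm d α p₂ T) * ENNReal.ofReal C_r *
              (∑' Q : 𝒮, (Q : Set S).indicator
                (fun _ => average μ (max p₁ p₂) (Q : Set S) f ^ r) s) ^ (1 / r)) := by
  refine ⟨?_, fun c₀ C₀ δ γ m hpar α hα => ?_⟩
  -- For `c_d < 1` there are no spaces of homogeneous type, and any parameters will do.
  · by_cases hc : 1 ≤ c_d
    · have hc3 : 1 ≤ c_d ^ 3 := one_le_pow₀ hc
      have hc8 : 1 ≤ c_d ^ 8 := one_le_pow₀ hc
      have hc0 : 0 < c_d := by linarith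
      refine ⟨_, _, _, _, _, ⟨?_, ?_, ?_, ?_, ?_⟩,
        fun S _ d μ hS => hS.exists_adjacentDyadicFamily⟩
      · positivity
      · rw [div_le_iff₀ (by positivity)]
        nlinarith
      · positivity
      · rw [div_lt_one (by positivity)]
        linarith
      · rw [adjacencyConst]
        linarith
    · exact ⟨1, 1, 1 / 2, 1, 0, ⟨by norm_num, by norm_num, by norm_num, by norm_num, by norm_num⟩,
        fun S _ d μ hS => absurd hS.isQuasiMetric.one_le hc⟩
  · set D : ℝ≥0 := doublingConst c_μ (2 * γ * α * C₀ / c₀) with hD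
    have hD1 : 1 ≤ D := one_le_doublingConst _ _
    have hD1' : (1 : ℝ) ≤ D := by exact_mod_cast hD1
    obtain ⟨N, hN⟩ := pow_unbounded_of_one_lt D (one_lt_two : (1 : ℝ≥0) < 2)
    refine ⟨1 / (2 * D), 2 * N * (2 * (24 * D ^ 2)) * D, by positivity, ?_, ?_⟩
    · rw [div_lt_one (by positivity)]
      linarith
    intro S _ d μ hS 𝒟 h𝒟 𝕜 _ X _ _ _ Y _ _ _ p₁ p₂ r hp₁ hp₂ hr T hA hM C_r hC_r hT f hf hfs
    -- In an empty space there need not be any system at all, since `m = 0` is possible.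
    rcases isEmpty_or_nonempty S with hE | hE
    · refine ⟨∅, by simp, ⟨fun _ => ∅, by simp, by simp⟩, ?_⟩
      exact Filter.Eventually.of_forall fun s => hE.elim s
    · exact h𝒟.exists_sparse_domination hpar hS hα hD hN hp₁ hp₂ hr hA hM hC_r hT hf hfs
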